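/- Let $d\in\mathbb N$, $a<t$, $x\in\mathbb R^d$, $0<\alpha<1$, $0<\beta\le 2$, $\sigma>0$, $|\rho|\le 1$, $m\in\mathbb R$. Let $X=(X_s)_{s\ge 0}$ be an isotropic $\beta$-stable process on $\mathbb R^d$ started at $x$, i.e. a Lévy process (independent stationary increments, a.s. càdlàg paths) with $X_0=x$ a.s. such that for every $s>0$ there is $b_s\in\mathbb R^d$ with $X_s-X_0\overset{d}{=}s^{1/\beta}(X_1-X_0)+b_s$, and such that all coordinates of $X_1-X_0$ have the same stable law $S_\beta(\sigma,\rho,m)$, with characteristic function $$z\mapsto\exp\Big(-\sigma^\beta|z|^\beta\big(1-i\rho\,\mathrm{sgn}(z)\tan\tfrac{\pi\beta}{2}\big)+imz\Big)\ (\beta\ne1),\qquad z\mapsto\exp\Big(-\sigma|z|\big(1+i\rho\tfrac{2}{\pi}\,\mathrm{sgn}(z)\log|z|\big)+imz\Big)\ (\beta=1)$$ (the symmetric case, with characteristic function $e^{-c|z|^\beta}$, is $\rho=m=0$, $c=\sigma^\beta$). Let $\tau=(\tau_s)_{s\ge0}$ be an $\alpha$-stable subordinator, i.e. a Lévy process on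 $\mathbb R$ started at $0$ with a.s. nondecreasing paths and $$\mathbb E[e^{iz\tau_1}]=\exp\Big(\int_0^\infty(e^{izy}-1)\frac{\alpha}{\Gamma(1-\alpha)}y^{-\alpha-1}\,dy\Big),\qquad z\in\mathbb R,$$ defined on the same probability space as $X$ and independent of $X$. Put $T_t=\inf\{s>0:\ t-\tau_s<a\}$. Let $\varphi:\mathbb R^d\to\mathbb R$ be continuous with $\varphi(y)=O(|y|^{\beta/(2+\delta)})$ as $|y|\to\infty$ for some $\delta>0$, and let $g:\mathbb R^d\to\mathbb R$ satisfy $|g(y)-g(z)|\le L\sum_{j=1}^d|y_j-z_j|^\gamma$ for all $y,z\in\mathbb R^d$, where $L\in\mathbb R$ and $0<\gamma<\beta/2$. For $h>0$ let $$Y_h(t,x)=\varphi(X_{T_t})+\sum_{i=1}^{\lfloor T_t/h\rfloor}h\,g(X_{t_i}),\qquad t_i=(i-1)h.$$ Then there is a constant $M^1_{t,x}$, which does not depend on $h$ and depends on the processes only through the parameters $\alpha,\beta,\sigma,\rho,m$ (besides $a,t,x,d,\varphi,g,\delta,\gamma,L$), such that for every $h>0$ the random variable $Y_h(t,x)$ is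 square integrable and $$\mathrm{Var}\,Y_h(t,x)\le M^1_{t,x}.$$ -/

import Mathlib

open MeasureTheory ProbabilityTheory Filter Topology
open scoped NNReal

noncomputable section

namespace FracMC

/-- The path `f` is right-continuous with left limits. -/
def IsCadlagPath {E : Type*} [TopologicalSpace E] (f : ℝ≥0 → E) : Prop :=
  ∀ s : ℝ≥0, ContinuousWithinAt f (Set.Ici s) s ∧ ∃ l : E, Tendsto f (𝓝[<] s) (𝓝 l)

/-- `X` is a Lévy process under `μ` started at `x`: it starts at `x` almost surely, has independent
and stationary increments, and almost all its paths are càdlàg. -/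
structure IsLevyProcess {Ω E : Type*} [MeasurableSpace Ω] [NormedAddCommGroup E]
    [MeasurableSpace E] (X : ℝ≥0 → Ω → E) (x : E) (μ : Measure Ω) : Prop where
  measurable : ∀ s, Measurable (X s)
  start : ∀ᵐ ω ∂μ, X 0 ω = x
  indep_increments : HasIndepIncrements X μ
  stationary_increments : ∀ s r : ℝ≥0,
    μ.map (fun ω => X (s + r) ω - X s ω) = μ.map (fun ω => X r ω - X 0 ω)
  cadlag : ∀ᵐ ω ∂μ, IsCadlagPath (fun s => X s ω)

/-- The characteristic function of the one-dimensional stable law `S_β(σ, ρ, m)` with index `β`,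
scale `σ`, skewness `ρ` and shift `m`. The symmetric case `ρ = m = 0` is `exp (-σ ^ β * |z| ^ β)`. -/
def stableCharFun (β σ ρ m z : ℝ) : ℂ :=
  if β = 1 then
    Complex.exp (-((σ * |z| : ℝ) : ℂ) *
        (1 + Complex.I * ((ρ * (2 / Real.pi) * Real.sign z * Real.log |z| : ℝ) : ℂ))
      + Complex.I * ((m * z : ℝ) : ℂ))
  else
    Complex.exp (-((σ ^ β * |z| ^ β : ℝ) : ℂ) *
        (1 - Complex.I * ((ρ * Real.sign z * Real.tan (Real.pi * β / 2) : ℝ) : ℂ))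
      + Complex.I * ((m * z : ℝ) : ℂ))

/-- `X` is an isotropic `β`-stable process on `ℝ^d` started at `x`: a Lévy process whose increment
over `[0, s]` has, up to a deterministic shift, the law of `s ^ (1 / β)` times its increment over
`[0, 1]`, and for which all coordinates of the increment over `[0, 1]` have the same law
`S_β(σ, ρ, m)`. -/
structure IsIsotropicStableProcess {Ω : Type*} [MeasurableSpace Ω] {d : ℕ} (β σ ρ m : ℝ)
    (X : ℝ≥0 → Ω → EuclideanSpace ℝ (Fin d)) (x : EuclideanSpace ℝ (Fin d)) (μ : Measure Ω) :
    Prop where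
  levy : IsLevyProcess X x μ
  stable : ∀ s : ℝ≥0, 0 < s → ∃ b : EuclideanSpace ℝ (Fin d),
    μ.map (fun ω => X s ω - X 0 ω) =
      μ.map (fun ω => ((s : ℝ) ^ (1 / β)) • (X 1 ω - X 0 ω) + b)
  isotropic : ∀ (j : Fin d) (z : ℝ),
    charFun (μ.map (fun ω => X 1 ω j - X 0 ω j)) z = stableCharFun β σ ρ m z

/-- `τ` is the `α`-stable subordinator: a Lévy process on `ℝ` started at `0`, with nondecreasing
paths, no drift and Lévy measure `α / Γ(1 - α) * y ^ (-α - 1) dy` on `(0, ∞)`. -/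
structure IsStableSubordinator {Ω : Type*} [MeasurableSpace Ω] (α : ℝ)
    (τ : ℝ≥0 → Ω → ℝ) (μ : Measure Ω) : Prop where
  levy : IsLevyProcess τ 0 μ
  mono : ∀ᵐ ω ∂μ, Monotone (fun s => τ s ω)
  charFun_one : ∀ z : ℝ, charFun (μ.map (τ 1)) z =
    Complex.exp (∫ y in Set.Ioi (0 : ℝ),
      (Complex.exp (Complex.I * ((z * y : ℝ) : ℂ)) - 1) *
        ((α / Real.Gamma (1 - α) * y ^ (-α - 1) : ℝ) : ℂ))

/-- `T_t = inf {s > 0 : t - τ_s < a}`. (The set is almost surely nonempty for the stable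
subordinator; the infimum of the empty set is `0` here.) -/
def hittingTime {Ω : Type*} (a t : ℝ) (τ : ℝ≥0 → Ω → ℝ) (ω : Ω) : ℝ≥0 :=
  sInf {s : ℝ≥0 | 0 < s ∧ t - τ s ω < a}

/-- `|y|_γ = ∑ j, |y_j| ^ γ`. -/
def gammaNorm {d : ℕ} (γ : ℝ) (y : EuclideanSpace ℝ (Fin d)) : ℝ :=
  ∑ j, |y j| ^ γ

/-- `Y_h = φ(X_T) + ∑_{i = 1}^{⌊T / h⌋} h g(X_{t_i})`, where `t_i = (i - 1) h`. -/
def discretized {Ω : Type*} {d : ℕ} (φ g : EuclideanSpace ℝ (Fin d) → ℝ)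
    (X : ℝ≥0 → Ω → EuclideanSpace ℝ (Fin d)) (T : Ω → ℝ≥0) (h : ℝ≥0) (ω : Ω) : ℝ :=
  φ (X (T ω) ω) +
    ∑ i ∈ Finset.Icc 1 ⌊T ω / h⌋₊, (h : ℝ) * g (X (((i - 1 : ℕ) : ℝ≥0) * h) ω)

end FracMC

end

/-! The variance is at most the second moment, so it suffices to bound `E[Y_h ^ 2]` by a constant
built from the parameters alone.

With `p = max (2γ) (2β / (2 + δ)) < β`, both `φ ^ 2` and `g ^ 2` grow at most like `1 + ∑ j, |y_j -
x_j| ^ p`, and the stable process has moments of order `p < β` bounded by `K (1 + s) ^ 2` at time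
`s`. Since `T` is independent of `X`, these bounds may be evaluated at the random time. For the
Riemann sum, Cauchy-Schwarz and `⌊T / h⌋ h ≤ T` produce a factor `T ^ 2` in which `h` has
disappeared. Everything is thus controlled by `E[(2 + T) ^ 4]` (`lintegral_sq_discretized_le`). This
is finite because `T` has a geometric tail: `T > n` forces the `n` independent unit increments of
`τ` to stay below `t - a`, and each does so with probability at most some `q < 1`.

Uniformity over all probability spaces comes from extracting every constant from characteristic
functions. The tool is `|y| ^ p ≲ ∫ (1 - cos (z y)) z ^ (-1 - p) dz`: integrated against a law it
gives moments from the behaviour of the characteristic function at `0`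
(`lintegral_rpow_le_of_charFun`), and with `p = α` it bounds the Lévy exponent of `τ`, which yields
`q`. The characteristic function of `X` is identified at rational times by taking continuous roots;
right-continuity and Fatou's lemma then reach all times, including random ones. -/

open scoped ENNReal

noncomputable section

namespace FracMC

/-! ### Cosine integrals and the Lévy exponent -/

section Analysis

/-- A constant such that `cosConst p * |y| ^ p` is at most `∫₀^∞ (1 - cos (z y)) z ^ (-1 - p) dz`. -/
def cosConst (p : ℝ) : ℝ := (1 - Real.cos 1) * 2 ^ (-1 - p)

lemma cosConst_pos (p : ℝ) : 0 < cosConst p := by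
  have h : Real.cos 1 < 1 := by
    have := Real.cos_lt_cos_of_nonneg_of_le_pi (x := 0) (y := 1) le_rfl
      (by linarith [Real.pi_gt_three]) one_pos
    simpa using this
  unfold cosConst
  have := sub_pos.2 h
  positivity

lemma cosConst_mul_rpow_le_lintegral {p : ℝ} (hp : 0 < p) (y : ℝ) :
    ENNReal.ofReal (cosConst p * |y| ^ p) ≤
      ∫⁻ z in Set.Ioi (0 : ℝ), ENNReal.ofReal ((1 - Real.cos (z * y)) * z ^ (-1 - p)) := by
  rcases eq_or_ne y 0 with rfl | hy
  · simp [Real.zero_rpow hp.ne']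
  have hu : 0 < |y| := abs_pos.2 hy
  set u := |y| with hu_def
  -- On this window `z * u` lies in `[1, 2] ⊆ [0, π]`, so the cosine is at most `cos 1`. The window
  -- has length `1 / u`, which gives exactly `cosConst p * u ^ p`.
  have h1 : ∀ z ∈ Set.Ioc (1 / u) (2 / u),
      ENNReal.ofReal ((1 - Real.cos 1) * (2 / u) ^ (-1 - p)) ≤
        ENNReal.ofReal ((1 - Real.cos (z * y)) * z ^ (-1 - p)) := by
    intro z hz
    have hz0 : 0 < z := lt_trans (by positivity) hz.1
    have hcos : Real.cos (z * y) = Real.cos (z * u) := by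
      rw [← Real.cos_abs, abs_mul, abs_of_pos hz0]
    have h1z : 1 ≤ z * u := by
      have := (div_lt_iff₀ hu).1 hz.1; exact this.le
    have h2z : z * u ≤ 2 := (le_div_iff₀ hu).1 hz.2
    have hle : Real.cos (z * u) ≤ Real.cos 1 :=
      Real.cos_le_cos_of_nonneg_of_le_pi zero_le_one (by linarith [Real.pi_gt_three]) h1z
    apply ENNReal.ofReal_le_ofReal
    rw [hcos]
    apply mul_le_mul (by linarith)
      (Real.rpow_le_rpow_of_nonpos hz0 hz.2 (by linarith)) (by positivity)
    linarith [Real.cos_le_one (z * u)]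
  calc ENNReal.ofReal (cosConst p * u ^ p)
      = ∫⁻ _ in Set.Ioc (1 / u) (2 / u), ENNReal.ofReal ((1 - Real.cos 1) * (2 / u) ^ (-1 - p)) := by
        rw [setLIntegral_const, Real.volume_Ioc, ← ENNReal.ofReal_mul]
        · congr 1
          rw [cosConst, Real.div_rpow zero_le_two hu.le, show (-1 - p) = -(1 + p) by ring,
            Real.rpow_neg hu.le, Real.rpow_add hu, Real.rpow_one]
          field_simp
          ring
        · have := Real.cos_le_one 1
          have : 0 ≤ 1 - Real.cos 1 := by linarith
          positivity
    _ ≤ ∫⁻ z in Set.Ioc (1 / u) (2 / u), ENNReal.ofReal ((1 - Real.cos (z * y)) * z ^ (-1 - p)) :=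
        setLIntegral_mono' measurableSet_Ioc h1
    _ ≤ _ := lintegral_mono_set fun z hz => lt_trans (by positivity) hz.1

/-- Near `0` the bound `|e^{izy} - 1| ≤ |z| y` leaves `y ^ (-α)`, integrable since `α < 1`; at
infinity the bound `2` suffices since `α > 0`. -/
lemma integrableOn_exp_sub_one_mul_rpow {α : ℝ} (hα0 : 0 < α) (hα1 : α < 1) (z : ℝ) (k : ℝ) :
    IntegrableOn (fun y : ℝ => (Complex.exp (Complex.I * ((z * y : ℝ) : ℂ)) - 1) *
      ((k * y ^ (-α - 1) : ℝ) : ℂ)) (Set.Ioi 0) := by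
  have hmeas : Measurable (fun y : ℝ => (Complex.exp (Complex.I * ((z * y : ℝ) : ℂ)) - 1) *
      ((k * y ^ (-α - 1) : ℝ) : ℂ)) := by fun_prop
  have hnorm : ∀ y : ℝ, 0 < y → ‖(Complex.exp (Complex.I * ((z * y : ℝ) : ℂ)) - 1) *
      ((k * y ^ (-α - 1) : ℝ) : ℂ)‖ = ‖Complex.exp (Complex.I * ((z * y : ℝ) : ℂ)) - 1‖ *
        (|k| * y ^ (-α - 1)) := by
    intro y hy
    rw [norm_mul, Complex.norm_real, Real.norm_eq_abs, abs_mul,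
      abs_of_nonneg (Real.rpow_nonneg hy.le _)]
  rw [← Set.Ioc_union_Ioi_eq_Ioi zero_le_one]
  apply IntegrableOn.union
  · have hi : IntegrableOn (fun y : ℝ => |z| * |k| * y ^ (-α)) (Set.Ioc 0 1) := by
      have := intervalIntegral.intervalIntegrable_rpow' (a := 0) (b := 1) (r := -α) (by linarith)
      rw [intervalIntegrable_iff_integrableOn_Ioc_of_le zero_le_one] at this
      exact this.const_mul _
    refine Integrable.mono' hi hmeas.aestronglyMeasurable ?_
    filter_upwards [ae_restrict_mem measurableSet_Ioc] with y hy
    rw [hnorm y hy.1]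
    have h1 : ‖Complex.exp (Complex.I * ((z * y : ℝ) : ℂ)) - 1‖ ≤ |z| * y := by
      have := Real.norm_exp_I_mul_ofReal_sub_one_le (x := z * y)
      rwa [Real.norm_eq_abs, abs_mul, abs_of_pos hy.1] at this
    calc _ ≤ |z| * y * (|k| * y ^ (-α - 1)) := by
          have := Real.rpow_nonneg hy.1.le (-α - 1)
          gcongr
      _ = |z| * |k| * y ^ (-α) := by
          rw [show -α = (-α - 1) + 1 by ring, Real.rpow_add_one hy.1.ne']
          ring_nf
  · have hi : IntegrableOn (fun y : ℝ => 2 * |k| * y ^ (-α - 1)) (Set.Ioi 1) :=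
      (integrableOn_Ioi_rpow_of_lt (by linarith) one_pos).const_mul _
    refine Integrable.mono' hi hmeas.aestronglyMeasurable ?_
    filter_upwards [ae_restrict_mem measurableSet_Ioi] with y hy
    have hy0 : 0 < y := lt_trans one_pos hy
    rw [hnorm y hy0]
    have h1 : ‖Complex.exp (Complex.I * ((z * y : ℝ) : ℂ)) - 1‖ ≤ 2 := by
      refine (norm_sub_le _ _).trans ?_
      rw [mul_comm, Complex.norm_exp_ofReal_mul_I]
      norm_num
    have := Real.rpow_nonneg hy0.le (-α - 1)
    calc _ ≤ 2 * (|k| * y ^ (-α - 1)) := by gcongr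
      _ = _ := by ring

lemma re_integral_exp_sub_one_mul_rpow_le {α : ℝ} (hα0 : 0 < α) (hα1 : α < 1) {z : ℝ} (hz : 0 < z)
    {k : ℝ} (hk : 0 ≤ k) :
    (∫ y in Set.Ioi (0 : ℝ), (Complex.exp (Complex.I * ((z * y : ℝ) : ℂ)) - 1) *
      ((k * y ^ (-α - 1) : ℝ) : ℂ)).re ≤ -(k * (cosConst α * z ^ α)) := by
  have hre : ∀ y : ℝ, ((Complex.exp (Complex.I * ((z * y : ℝ) : ℂ)) - 1) *
      ((k * y ^ (-α - 1) : ℝ) : ℂ)).re = -(k * ((1 - Real.cos (y * z)) * y ^ (-1 - α))) := by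
    intro y
    rw [mul_comm Complex.I, Complex.re_mul_ofReal, Complex.sub_re, Complex.exp_ofReal_mul_I_re,
      Complex.one_re, mul_comm z y, show -1 - α = -α - 1 by ring]
    ring
  have hint := integrableOn_exp_sub_one_mul_rpow hα0 hα1 z 1
  have hint' : IntegrableOn (fun y : ℝ => (1 - Real.cos (y * z)) * y ^ (-1 - α)) (Set.Ioi 0) := by
    refine (hint.re.neg).congr (Eventually.of_forall fun y => ?_)
    simp only [RCLike.re_eq_complex_re, Pi.neg_apply]
    rw [mul_comm Complex.I, Complex.re_mul_ofReal, Complex.sub_re, Complex.exp_ofReal_mul_I_re,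
      Complex.one_re, mul_comm z y, show -1 - α = -α - 1 by ring]
    ring
  have h0 : ∀ᵐ y ∂(volume.restrict (Set.Ioi (0 : ℝ))),
      0 ≤ (1 - Real.cos (y * z)) * y ^ (-1 - α) := by
    filter_upwards [ae_restrict_mem measurableSet_Ioi] with y hy
    exact mul_nonneg (by linarith [Real.cos_le_one (y * z)]) (Real.rpow_nonneg (le_of_lt hy) _)
  have hlow : cosConst α * z ^ α ≤
      ∫ y in Set.Ioi (0 : ℝ), (1 - Real.cos (y * z)) * y ^ (-1 - α) := by
    have := cosConst_mul_rpow_le_lintegral hα0 z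
    rw [← ofReal_integral_eq_lintegral_ofReal hint' h0, abs_of_pos hz] at this
    exact (ENNReal.ofReal_le_ofReal_iff (integral_nonneg_of_ae h0)).1 this
  have hcomm := integral_re (integrableOn_exp_sub_one_mul_rpow hα0 hα1 z k)
  simp only [RCLike.re_eq_complex_re] at hcomm
  rw [← hcomm]
  simp_rw [hre]
  rw [integral_neg, integral_const_mul]
  gcongr

end Analysis

/-! ### The subordinator and the tail of its hitting time -/

section Subordinator

lemma re_charFun_eq_integral_cos (ν : Measure ℝ) [IsFiniteMeasure ν] (z : ℝ) :
    (charFun ν z).re = ∫ y, Real.cos (z * y) ∂ν := by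
  have hint : Integrable (fun y : ℝ => Complex.exp (((z * y : ℝ) : ℂ) * Complex.I)) ν := by
    refine Integrable.of_bound (C := 1) (by fun_prop) (Eventually.of_forall fun y => ?_)
    rw [Complex.norm_exp_ofReal_mul_I]
  have h := integral_re hint
  simp only [RCLike.re_eq_complex_re, Complex.exp_ofReal_mul_I_re] at h
  rw [h, charFun_apply_real]
  push_cast
  rfl

lemma integrable_cos_mul (ν : Measure ℝ) [IsFiniteMeasure ν] (z : ℝ) :
    Integrable (fun y => Real.cos (z * y)) ν := by
  refine Integrable.of_bound (C := 1) (by fun_prop) (Eventually.of_forall fun y => ?_)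
  rw [Real.norm_eq_abs]
  exact Real.abs_cos_le_one _

/-- If a nonnegative random variable lies below `b` with large probability, its characteristic
function is close to `1` near the origin. -/
lemma one_sub_re_charFun_le {ν : Measure ℝ} [IsProbabilityMeasure ν] (hν : ∀ᵐ y ∂ν, 0 ≤ y)
    {b z : ℝ} (hz : 0 ≤ z) :
    1 - (charFun ν z).re ≤ (z * b) ^ 2 / 2 + 2 * ν.real (Set.Ioi b) := by
  have hc := integrable_cos_mul ν z
  have h1 : 1 - (charFun ν z).re = ∫ y, (1 - Real.cos (z * y)) ∂ν := by
    rw [re_charFun_eq_integral_cos, integral_sub (integrable_const _) hc]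
    simp
  have hi : Integrable ((Set.Ioi b).indicator fun _ : ℝ => (2 : ℝ)) ν :=
    (integrable_const _).indicator measurableSet_Ioi
  have h2 : ∫ y, ((z * b) ^ 2 / 2 + (Set.Ioi b).indicator (fun _ : ℝ => (2 : ℝ)) y) ∂ν =
      (z * b) ^ 2 / 2 + 2 * ν.real (Set.Ioi b) := by
    rw [integral_add (integrable_const _) hi, integral_indicator_const _ measurableSet_Ioi]
    simp [mul_comm]
  rw [h1, ← h2]
  refine integral_mono_ae ((integrable_const _).sub hc) ((integrable_const _).add hi) ?_
  filter_upwards [hν] with y hy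
  by_cases hyb : y ∈ Set.Ioi b
  · simp only [Set.indicator_of_mem hyb]
    nlinarith [Real.neg_one_le_cos (z * y), sq_nonneg (z * b)]
  · simp only [Set.indicator_of_notMem hyb]
    have hyb' : y ≤ b := not_lt.1 hyb
    have h3 := Real.one_sub_sq_div_two_le_cos (x := z * y)
    have h4 : (z * y) ^ 2 ≤ (z * b) ^ 2 := by
      have : 0 ≤ z * y := by positivity
      gcongr
    linarith

lemma IsStableSubordinator.ae_nonneg {Ω : Type*} [MeasurableSpace Ω] {μ : Measure Ω} {α : ℝ}
    {τ : ℝ≥0 → Ω → ℝ} (hτ : IsStableSubordinator α τ μ) (s : ℝ≥0) : ∀ᵐ ω ∂μ, 0 ≤ τ s ω := by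
  filter_upwards [hτ.levy.start, hτ.mono] with ω h0 hm
  rw [← h0]
  exact hm zero_le

/-- As `z → 0`, the quadratic term is negligible against `z ^ α`, while `1 - e^{-u} ≥ u / (1 + u)`
for `u = c z ^ α`. -/
lemma exists_small_scale {α c b : ℝ} (hα1 : α < 1) (hc : 0 < c) :
    ∃ z : ℝ, 0 < z ∧ (z * b) ^ 2 / 2 < 1 - Real.exp (-(c * z ^ α)) := by
  have ht : Tendsto (fun z : ℝ => z ^ (2 - α) * b ^ 2 / 2) (𝓝[>] 0) (𝓝 0) := by
    have := (Real.continuousAt_rpow_const 0 (2 - α) (Or.inr (by linarith))).tendsto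
    rw [Real.zero_rpow (by linarith)] at this
    simpa using ((this.mul_const (b ^ 2)).div_const 2).mono_left nhdsWithin_le_nhds
  have h2 : Tendsto (fun z : ℝ => (z * b) ^ 2 / 2) (𝓝[>] 0) (𝓝 0) := by
    have : Continuous fun z : ℝ => (z * b) ^ 2 / 2 := by fun_prop
    simpa using (this.tendsto 0).mono_left (nhdsWithin_le_nhds (s := Set.Ioi 0))
  have hself : ∀ᶠ z : ℝ in 𝓝[>] 0, 0 < z := self_mem_nhdsWithin
  obtain ⟨z, hz0, hz1, hz2⟩ := (hself.and
    ((ht.eventually (gt_mem_nhds (show 0 < c / 2 by positivity))).and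
      (h2.eventually (gt_mem_nhds (show (0 : ℝ) < 1 / 2 by norm_num))))).exists
  refine ⟨z, hz0, ?_⟩
  set u := c * z ^ α with hu
  have hu0 : 0 < u := by positivity
  have hexp : Real.exp (-u) ≤ 1 / (1 + u) := by
    rw [Real.exp_neg, ← one_div]
    exact one_div_le_one_div_of_le (by positivity) (by linarith [Real.add_one_le_exp u])
  have hlow : u / (1 + u) ≤ 1 - Real.exp (-u) := by
    have : u / (1 + u) = 1 - 1 / (1 + u) := by field_simp; ring
    linarith
  refine lt_of_lt_of_le ?_ hlow
  rw [lt_div_iff₀ (by positivity)]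
  have h3 : (z * b) ^ 2 / 2 = z ^ (2 - α) * b ^ 2 / 2 * z ^ α := by
    have : z ^ (2 - α) * z ^ α = z ^ 2 := by
      rw [← Real.rpow_add hz0, sub_add_cancel, Real.rpow_two]
    rw [mul_pow, ← this]; ring
  have h4 : (z * b) ^ 2 / 2 < u / 2 := by
    have := mul_lt_mul_of_pos_right hz1 (Real.rpow_pos_of_pos hz0 α)
    rw [h3, hu]
    linarith
  -- The left side `A = (z b) ^ 2 / 2` is below both `u / 2` and `1 / 2`, so `A (1 + u) < u / 2 + u
  -- / 2`.
  nlinarith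

/-- The probability that the `α`-stable subordinator stays below `b` up to time `1` is bounded away
from `1`, with a bound depending only on `α` and `b`. -/
lemma exists_measure_subordinator_le {α : ℝ} (hα0 : 0 < α) (hα1 : α < 1) (b : ℝ) :
    ∃ q : ℝ, 0 ≤ q ∧ q < 1 ∧ ∀ (Ω : Type*) [MeasurableSpace Ω] (μ : Measure Ω)
      [IsProbabilityMeasure μ] (τ : ℝ≥0 → Ω → ℝ), IsStableSubordinator α τ μ →
      μ {ω | τ 1 ω ≤ b} ≤ ENNReal.ofReal q := by
  have hk : 0 < α / Real.Gamma (1 - α) := div_pos hα0 (Real.Gamma_pos_of_pos (by linarith))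
  set k := α / Real.Gamma (1 - α) with hk_def
  have hc : 0 < k * cosConst α := mul_pos hk (cosConst_pos α)
  obtain ⟨z, hz0, hz⟩ := exists_small_scale (b := b) hα1 hc
  -- Solving `one_sub_re_charFun_le` for the mass above `b` gives at least `e`; `z` was chosen to
  -- make `e` positive.
  set e := (1 - Real.exp (-(k * cosConst α * z ^ α)) - (z * b) ^ 2 / 2) / 2 with he
  have he0 : 0 < e := by rw [he]; linarith
  have he1 : e ≤ 1 := by
    rw [he]; linarith [Real.exp_pos (-(k * cosConst α * z ^ α)), sq_nonneg (z * b)]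
  refine ⟨1 - e, by linarith, by linarith, fun Ω _ μ _ τ hτ => ?_⟩
  have hm := hτ.levy.measurable 1
  have : IsProbabilityMeasure (μ.map (τ 1)) := Measure.isProbabilityMeasure_map hm.aemeasurable
  set ν := μ.map (τ 1) with hν
  have hν0 : ∀ᵐ y ∂ν, 0 ≤ y :=
    (ae_map_iff hm.aemeasurable measurableSet_Ici).2 (hτ.ae_nonneg 1)
  have h1 := one_sub_re_charFun_le hν0 (b := b) hz0.le
  have h2 : (charFun ν z).re ≤ Real.exp (-(k * cosConst α * z ^ α)) := by
    refine (Complex.re_le_norm _).trans ?_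
    rw [hτ.charFun_one, Complex.norm_exp, mul_assoc]
    exact Real.exp_le_exp.2 (re_integral_exp_sub_one_mul_rpow_le hα0 hα1 hz0 hk.le)
  have h3 : e ≤ ν.real (Set.Ioi b) := by rw [he]; linarith
  have h4 : ν.real (Set.Iic b) ≤ 1 - e := by
    have := probReal_compl_eq_one_sub (μ := ν) (measurableSet_Ioi (a := b))
    rw [Set.compl_Ioi] at this
    linarith
  have h5 : μ {ω | τ 1 ω ≤ b} = ν (Set.Iic b) := by
    rw [hν, Measure.map_apply hm measurableSet_Iic]; rfl
  rw [h5, ← ofReal_measureReal]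
  exact ENNReal.ofReal_le_ofReal h4

/-- A nondecreasing path from `0` with `τ n ≤ b` has all its first `n` unit increments at most `b`;
these are independent, each distributed as `τ 1`. -/
lemma IsStableSubordinator.measure_le_pow {Ω : Type*} [MeasurableSpace Ω] {μ : Measure Ω}
    {α b : ℝ} {τ : ℝ≥0 → Ω → ℝ} (hτ : IsStableSubordinator α τ μ) {q : ℝ≥0∞}
    (hq : μ {ω | τ 1 ω ≤ b} ≤ q) (n : ℕ) : μ {ω | τ n ω ≤ b} ≤ q ^ n := by
  have hind := hτ.levy.indep_increments.nat (t := fun i : ℕ => (i : ℝ≥0)) Nat.mono_cast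
  have hinc : ∀ i : ℕ, μ ((fun ω => τ ((i + 1 : ℕ) : ℝ≥0) ω - τ (i : ℝ≥0) ω) ⁻¹' Set.Iic b) ≤ q := by
    intro i
    have hst := hτ.levy.stationary_increments i 1
    have hm : ∀ s, Measurable (τ s) := hτ.levy.measurable
    have hmd : ∀ s r, Measurable fun ω => τ s ω - τ r ω := fun s r => (hm s).sub (hm r)
    rw [← Measure.map_apply (hmd _ _) measurableSet_Iic, Nat.cast_add_one, hst,
      Measure.map_apply (hmd _ _) measurableSet_Iic]
    refine le_trans (measure_mono_ae ?_) hq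
    filter_upwards [hτ.levy.start] with ω h0 h
    have h' : τ 1 ω - τ 0 ω ≤ b := h
    rw [h0, sub_zero] at h'
    exact h'
  have hprod := hind.measure_inter_preimage_eq_mul (Finset.range n)
    (sets := fun _ => Set.Iic b) (fun _ _ => measurableSet_Iic)
  calc μ {ω | τ n ω ≤ b} ≤ μ (⋂ i ∈ Finset.range n,
        (fun ω => τ ((i + 1 : ℕ) : ℝ≥0) ω - τ (i : ℝ≥0) ω) ⁻¹' Set.Iic b) := by
        refine measure_mono_ae ?_
        filter_upwards [hτ.mono, hτ.levy.start] with ω hmono h0 h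
        have h' : τ n ω ≤ b := h
        refine Set.mem_iInter₂.2 fun i hi => ?_
        have h1 : τ ((i + 1 : ℕ) : ℝ≥0) ω ≤ τ n ω :=
          hmono (Nat.cast_le.2 (Finset.mem_range.1 hi))
        have h2 : τ 0 ω ≤ τ (i : ℝ≥0) ω := hmono zero_le
        rw [h0] at h2
        change τ ((i + 1 : ℕ) : ℝ≥0) ω - τ (i : ℝ≥0) ω ≤ b
        linarith
    _ = ∏ i ∈ Finset.range n, μ ((fun ω => τ ((i + 1 : ℕ) : ℝ≥0) ω - τ (i : ℝ≥0) ω) ⁻¹'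
          Set.Iic b) := hprod
    _ ≤ ∏ _i ∈ Finset.range n, q := Finset.prod_le_prod' fun i _ => hinc i
    _ = q ^ n := by simp

/-- First passage above level `b`, computed along a countable dense set of times; a measurable
functional of the path. -/
def countableHitting (b : ℝ) (f : ℝ≥0 → ℝ) : ℝ≥0 :=
  (⨅ n : ℕ, if 0 < TopologicalSpace.denseSeq ℝ≥0 n ∧ b < f (TopologicalSpace.denseSeq ℝ≥0 n)
    then (TopologicalSpace.denseSeq ℝ≥0 n : ℝ≥0∞) else ⊤).toNNReal

lemma measurable_countableHitting (b : ℝ) : Measurable (countableHitting b) := by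
  refine ENNReal.measurable_toNNReal.comp (Measurable.iInf fun n => Measurable.ite ?_
    measurable_const measurable_const)
  exact (MeasurableSet.const _).inter (measurableSet_lt measurable_const (measurable_pi_apply _))

/-- Along a monotone path the passage set is upward closed, so dense times approach its infimum.
This makes `T` almost surely a measurable functional of the path of `τ`, hence independent of `X`.
-/
lemma hittingTime_eq_countableHitting {Ω : Type*} (a t : ℝ) (τ : ℝ≥0 → Ω → ℝ) (ω : Ω)
    (hmono : Monotone fun s => τ s ω) :
    hittingTime a t τ ω = countableHitting (t - a) (fun s => τ s ω) := by
  have hset : {s : ℝ≥0 | 0 < s ∧ t - τ s ω < a} = {s : ℝ≥0 | 0 < s ∧ t - a < τ s ω} := by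
    ext s
    exact and_congr_right fun _ => by constructor <;> intro h <;> linarith
  rw [hittingTime, hset, countableHitting]
  set S := {s : ℝ≥0 | 0 < s ∧ t - a < τ s ω} with hS
  rcases S.eq_empty_or_nonempty with h | h
  · have hno : ∀ s : ℝ≥0, ¬ (0 < s ∧ t - a < τ s ω) := fun s hs => by
      have : s ∈ S := hs
      simp [h] at this
    -- If the level is never passed, the conventions agree: `sInf ∅ = 0` in `ℝ≥0` and `⊤.toNNReal =
    -- 0`.
    simp [h, hno]
  · suffices hsuff : (⨅ n : ℕ, if 0 < TopologicalSpace.denseSeq ℝ≥0 n ∧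
        t - a < τ (TopologicalSpace.denseSeq ℝ≥0 n) ω
        then (TopologicalSpace.denseSeq ℝ≥0 n : ℝ≥0∞) else ⊤) = ((sInf S : ℝ≥0) : ℝ≥0∞) by
      rw [hsuff, ENNReal.toNNReal_coe]
    apply le_antisymm
    · refine le_of_forall_gt fun r hr => ?_
      obtain ⟨r', hr1, hr2⟩ := ENNReal.lt_iff_exists_nnreal_btwn.1 hr
      obtain ⟨s, hs, hsr⟩ := exists_lt_of_csInf_lt h (ENNReal.coe_lt_coe.1 hr1)
      obtain ⟨_, ⟨n, rfl⟩, hn1, hn2⟩ :=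
        (TopologicalSpace.denseRange_denseSeq ℝ≥0).exists_between hsr
      refine lt_of_le_of_lt (iInf_le _ n) ?_
      rw [if_pos ⟨hs.1.trans hn1, hs.2.trans_le (hmono hn1.le)⟩]
      exact (ENNReal.coe_lt_coe.2 hn2).trans hr2
    · refine le_iInf fun n => ?_
      split_ifs with hn
      · exact ENNReal.coe_le_coe.2 (csInf_le' hn)
      · exact le_top

lemma measure_lt_hittingTime_le {Ω : Type*} [MeasurableSpace Ω] {μ : Measure Ω}
    [IsProbabilityMeasure μ] {α a t : ℝ}
    {τ : ℝ≥0 → Ω → ℝ} (hτ : IsStableSubordinator α τ μ) {q : ℝ≥0∞}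
    (hq : μ {ω | τ 1 ω ≤ t - a} ≤ q) (n : ℕ) :
    μ {ω | (n : ℝ≥0) < hittingTime a t τ ω} ≤ q ^ n := by
  -- Time `0` is excluded from the passage set, so `n = 0` is separate, with trivial bound `q ^ 0 =
  -- 1`.
  rcases n.eq_zero_or_pos with rfl | hn
  · simpa using prob_le_one
  refine (measure_mono fun ω hω => ?_).trans (hτ.measure_le_pow hq n)
  by_contra hlt
  have hlt' : t - a < τ n ω := not_le.1 hlt
  have : hittingTime a t τ ω ≤ n := csInf_le' ⟨Nat.cast_pos.2 hn, by linarith⟩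
  exact absurd hω (not_lt.2 this)

lemma tsum_pow_four_mul_geometric_ne_top {q : ℝ} (hq0 : 0 ≤ q) (hq1 : q < 1) :
    ∑' n : ℕ, ((n : ℝ≥0∞) + 3) ^ 4 * ENNReal.ofReal q ^ n ≠ ⊤ := by
  have hs : Summable fun n : ℕ => ((n : ℝ) + 3) ^ 4 * q ^ n := by
    have h4 := summable_pow_mul_geometric_of_norm_lt_one 4 (r := q)
      (by rwa [Real.norm_eq_abs, abs_of_nonneg hq0])
    have h0 := summable_geometric_of_lt_one hq0 hq1
    refine Summable.of_nonneg_of_le (fun n => by positivity) (fun n => ?_)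
      ((h4.mul_left 8).add (h0.mul_left 648))
    have h1 : ((n : ℝ) + 3) ^ 4 ≤ 8 * n ^ 4 + 648 := by
      have := add_pow_le (Nat.cast_nonneg (α := ℝ) n) (by norm_num : (0 : ℝ) ≤ 3) 4
      norm_num at this
      linarith
    calc ((n : ℝ) + 3) ^ 4 * q ^ n ≤ (8 * n ^ 4 + 648) * q ^ n := by gcongr
      _ = _ := by ring
  have heq : ∀ n : ℕ, ((n : ℝ≥0∞) + 3) ^ 4 * ENNReal.ofReal q ^ n =
      ENNReal.ofReal (((n : ℝ) + 3) ^ 4 * q ^ n) := by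
    intro n
    rw [ENNReal.ofReal_mul (by positivity), ENNReal.ofReal_pow (by positivity),
      ENNReal.ofReal_pow hq0, ENNReal.ofReal_add (by positivity) (by norm_num),
      ENNReal.ofReal_natCast]
    norm_num
  simp_rw [heq]
  exact hs.tsum_ofReal_ne_top

/-- On `n < T ≤ n + 1` the single term of index `n` already dominates `(2 + T) ^ 4`; the constant
`16` covers `T = 0`. -/
lemma lintegral_two_add_pow_four_le {Ω : Type*} [MeasurableSpace Ω] {μ : Measure Ω}
    [IsProbabilityMeasure μ] {T : Ω → ℝ≥0} (hT : Measurable T) {q : ℝ≥0∞}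
    (hq : ∀ n : ℕ, μ {ω | (n : ℝ≥0) < T ω} ≤ q ^ n) :
    ∫⁻ ω, (2 + (T ω : ℝ≥0∞)) ^ 4 ∂μ ≤ 16 + ∑' n : ℕ, ((n : ℝ≥0∞) + 3) ^ 4 * q ^ n := by
  have hset : ∀ n : ℕ, MeasurableSet {ω | (n : ℝ≥0) < T ω} :=
    fun n => measurableSet_lt measurable_const hT
  have hpt : ∀ ω, (2 + (T ω : ℝ≥0∞)) ^ 4 ≤ 16 + ∑' n : ℕ,
      {ω | (n : ℝ≥0) < T ω}.indicator (fun _ => ((n : ℝ≥0∞) + 3) ^ 4) ω := by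
    intro ω
    rcases eq_or_ne (T ω) 0 with h0 | h0
    · rw [h0]; norm_num
    · have hpos : 0 < ⌈T ω⌉₊ := Nat.ceil_pos.2 (pos_iff_ne_zero.2 h0)
      obtain ⟨n, hn⟩ := Nat.exists_eq_succ_of_ne_zero hpos.ne'
      have h1 : (n : ℝ≥0) < T ω := Nat.lt_ceil.1 (by omega)
      have h2 : T ω ≤ (n : ℝ≥0) + 1 := by
        have := Nat.le_ceil (T ω)
        rw [hn] at this
        simpa using this
      refine le_trans ?_ (le_add_self.trans (add_le_add_right (ENNReal.le_tsum n) _))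
      rw [Set.indicator_of_mem (by exact h1)]
      have h3 : (T ω : ℝ≥0∞) ≤ (n : ℝ≥0∞) + 1 := by exact_mod_cast h2
      calc (2 + (T ω : ℝ≥0∞)) ^ 4 ≤ (2 + ((n : ℝ≥0∞) + 1)) ^ 4 := by gcongr
        _ = ((n : ℝ≥0∞) + 3) ^ 4 := by ring
  calc _ ≤ ∫⁻ ω, (16 + ∑' n : ℕ,
        {ω | (n : ℝ≥0) < T ω}.indicator (fun _ => ((n : ℝ≥0∞) + 3) ^ 4) ω) ∂μ := lintegral_mono hpt
    _ = 16 + ∑' n : ℕ, ((n : ℝ≥0∞) + 3) ^ 4 * μ {ω | (n : ℝ≥0) < T ω} := by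
        rw [lintegral_add_left measurable_const, lintegral_tsum
          fun n => (measurable_const.indicator (hset n)).aemeasurable]
        simp only [lintegral_const, measure_univ, mul_one]
        congr 2
        ext n
        rw [lintegral_indicator_const (hset n)]
    _ ≤ _ := by
        gcongr with n
        exact hq n

/-- The time change has fourth moments bounded in terms of `α`, `a`, `t` only. -/
lemma exists_moment_bound_hitting {α : ℝ} (hα0 : 0 < α) (hα1 : α < 1) (a t : ℝ) :
    ∃ K : ℝ≥0∞, K ≠ ⊤ ∧ ∀ (Ω : Type*) [MeasurableSpace Ω] (μ : Measure Ω)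
      [IsProbabilityMeasure μ] (τ : ℝ≥0 → Ω → ℝ), IsStableSubordinator α τ μ →
      ∫⁻ ω, (2 + (countableHitting (t - a) (fun s => τ s ω) : ℝ≥0∞)) ^ 4 ∂μ ≤ K := by
  obtain ⟨q, hq0, hq1, hq⟩ := exists_measure_subordinator_le hα0 hα1 (t - a)
  refine ⟨16 + ∑' n : ℕ, ((n : ℝ≥0∞) + 3) ^ 4 * ENNReal.ofReal q ^ n,
    ENNReal.add_ne_top.2 ⟨by norm_num, tsum_pow_four_mul_geometric_ne_top hq0 hq1⟩,
    fun Ω _ μ _ τ hτ => ?_⟩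
  refine lintegral_two_add_pow_four_le ((measurable_countableHitting _).comp
    (measurable_pi_lambda _ hτ.levy.measurable)) fun n => ?_
  refine (measure_mono_ae ?_).trans (measure_lt_hittingTime_le hτ (hq Ω μ τ hτ) n)
  filter_upwards [hτ.mono] with ω hmono h
  change (n : ℝ≥0) < hittingTime a t τ ω
  rw [hittingTime_eq_countableHitting a t τ ω hmono]
  exact h

end Subordinator

/-! ### Moments of the stable process at rational times -/

section StableMoments

/-- The exponent of the characteristic function of `S_β(σ, ρ, 0)` on the half line `[0, ∞)`. -/
def stableExponent (β σ ρ z : ℝ) : ℂ :=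
  if β = 1 then
    -((σ * z : ℝ) : ℂ) - Complex.I * ((σ * ρ * (2 / Real.pi) * (z * Real.log z) : ℝ) : ℂ)
  else
    -((σ ^ β * z ^ β : ℝ) : ℂ) * (1 - Complex.I * ((ρ * Real.tan (Real.pi * β / 2) : ℝ) : ℂ))

lemma stableCharFun_eq_exp {β σ ρ m z : ℝ} (hβ : 0 < β) (hz : 0 ≤ z) :
    stableCharFun β σ ρ m z =
      Complex.exp (stableExponent β σ ρ z + Complex.I * ((m * z : ℝ) : ℂ)) := by
  unfold stableCharFun stableExponent
  rcases hz.eq_or_lt with rfl | hz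
  · split_ifs <;> simp [Real.zero_rpow hβ.ne']
  · rw [abs_of_pos hz, Real.sign_of_pos hz]
    split_ifs
    · congr 2
      push_cast
      ring
    · congr 2
      simp

lemma stableExponent_zero {β σ ρ : ℝ} (hβ : 0 < β) : stableExponent β σ ρ 0 = 0 := by
  unfold stableExponent
  split_ifs <;> simp [Real.zero_rpow hβ.ne']

lemma re_stableExponent_nonpos {β σ ρ z : ℝ} (hσ : 0 < σ) (hz : 0 ≤ z) :
    (stableExponent β σ ρ z).re ≤ 0 := by
  unfold stableExponent
  split_ifs
  · rw [Complex.sub_re, Complex.neg_re, Complex.ofReal_re, Complex.I_mul_re, Complex.ofReal_im]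
    have : 0 ≤ σ * z := by positivity
    linarith
  · rw [← Complex.ofReal_neg, Complex.re_ofReal_mul, Complex.sub_re, Complex.one_re,
      Complex.I_mul_re, Complex.ofReal_im]
    have : 0 ≤ σ ^ β * z ^ β := by positivity
    linarith

lemma continuous_stableExponent {β σ ρ : ℝ} (hβ : 0 < β) :
    Continuous (stableExponent β σ ρ) := by
  have h1 := Real.continuous_mul_log
  have h2 := Real.continuous_rpow_const hβ.le
  unfold stableExponent
  split_ifs <;> fun_prop

/-- The strict inequality `q < β` absorbs the term `z log z` present when `β = 1`. -/
lemma exists_norm_stableExponent_le {β σ ρ q : ℝ} (hσ : 0 < σ) (hq : q < β) :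
    ∃ C : ℝ, 0 ≤ C ∧ ∀ z : ℝ, 0 < z → z ≤ 1 → ‖stableExponent β σ ρ z‖ ≤ C * z ^ q := by
  unfold stableExponent
  split_ifs with h
  · subst h
    have hπ := Real.pi_pos
    have ht : 0 < 1 - q := by linarith
    refine ⟨σ + |σ * ρ * (2 / Real.pi)| * (1 / (1 - q)), by positivity, fun z hz0 hz1 => ?_⟩
    have h1 : ‖-((σ * z : ℝ) : ℂ)‖ ≤ σ * z ^ q := by
      rw [norm_neg, Complex.norm_real, Real.norm_eq_abs, abs_of_pos (by positivity)]
      gcongr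
      simpa using Real.rpow_le_rpow_of_exponent_ge hz0 hz1 hq.le
    have h2 : |z * Real.log z| ≤ 1 / (1 - q) * z ^ q := by
      have := (Real.abs_log_mul_self_rpow_lt z (1 - q) hz0 hz1 ht).le
      have hz : z = z ^ (1 - q) * z ^ q := by
        rw [← Real.rpow_add hz0]; simp
      calc |z * Real.log z| = |Real.log z * z ^ (1 - q)| * z ^ q := by
            nth_rewrite 1 [hz]
            rw [abs_mul, abs_mul, abs_mul, abs_of_pos (Real.rpow_pos_of_pos hz0 q)]
            ring
        _ ≤ _ := by gcongr
    calc _ ≤ _ := norm_sub_le _ _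
      _ ≤ σ * z ^ q + |σ * ρ * (2 / Real.pi)| * (1 / (1 - q) * z ^ q) := by
          gcongr
          rw [norm_mul, Complex.norm_I, one_mul, Complex.norm_real, Real.norm_eq_abs, abs_mul]
          gcongr
      _ = _ := by ring
  · refine ⟨σ ^ β * ‖1 - Complex.I * ((ρ * Real.tan (Real.pi * β / 2) : ℝ) : ℂ)‖,
      by positivity, fun z hz0 hz1 => ?_⟩
    rw [norm_mul, norm_neg, Complex.norm_real, Real.norm_eq_abs, abs_of_pos (by positivity)]
    have := Real.rpow_le_rpow_of_exponent_ge hz0 hz1 hq.le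
    calc _ ≤ σ ^ β * z ^ q * ‖1 - Complex.I * ((ρ * Real.tan (Real.pi * β / 2) : ℝ) : ℂ)‖ := by
          gcongr
      _ = _ := by ring

lemma norm_one_sub_exp_le {w : ℂ} (hw : w.re ≤ 0) : ‖1 - Complex.exp w‖ ≤ 2 * ‖w‖ := by
  rcases le_total ‖w‖ 1 with h | h
  · rw [norm_sub_rev]
    exact Complex.norm_exp_sub_one_le h
  · refine (norm_sub_le _ _).trans ?_
    rw [norm_one, Complex.norm_exp]
    have := Real.exp_le_one_iff.2 hw
    linarith

/-- A measure whose characteristic function is close to `1` at the origin to order `q > p` has a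
finite moment of order `p`. -/
lemma lintegral_rpow_le_of_charFun {p q B : ℝ} (hp : 0 < p) (hpq : p < q) (hB : 0 ≤ B)
    (ν : Measure ℝ) [IsProbabilityMeasure ν]
    (h : ∀ z : ℝ, 0 < z → z ≤ 1 → 1 - (charFun ν z).re ≤ B * z ^ q) :
    ∫⁻ y, ENNReal.ofReal (cosConst p * |y| ^ p) ∂ν ≤ ENNReal.ofReal (B / (q - p) + 2 / p) := by
  -- By Tonelli, the moment is bounded by `∫ (1 - Re charFun) z ^ (-1 - p) dz`. The hypothesis
  -- handles `z ≤ 1`, where `q > p` gives convergence; for `z > 1` the bound `1 - Re charFun ≤ 2` is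
  -- enough.
  have hinner : ∀ z : ℝ, 0 < z →
      ∫⁻ y, ENNReal.ofReal ((1 - Real.cos (z * y)) * z ^ (-1 - p)) ∂ν =
        ENNReal.ofReal ((1 - (charFun ν z).re) * z ^ (-1 - p)) := by
    intro z hz
    have hc := integrable_cos_mul ν z
    have hsub : Integrable (fun y => 1 - Real.cos (z * y)) ν := (integrable_const _).sub hc
    rw [← ofReal_integral_eq_lintegral_ofReal (hsub.mul_const _),
      integral_mul_const, integral_sub (integrable_const _) hc, re_charFun_eq_integral_cos]
    · simp
    · exact Eventually.of_forall fun y => mul_nonneg (by linarith [Real.cos_le_one (z * y)])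
        (Real.rpow_nonneg hz.le _)
  have h1 : ∫⁻ z in Set.Ioc (0 : ℝ) 1, ENNReal.ofReal ((1 - (charFun ν z).re) * z ^ (-1 - p)) ≤
      ENNReal.ofReal (B / (q - p)) := by
    have hi : IntegrableOn (fun z : ℝ => B * z ^ (q - p - 1)) (Set.Ioc 0 1) := by
      have := intervalIntegral.intervalIntegrable_rpow' (a := 0) (b := 1) (r := q - p - 1)
        (by linarith)
      rw [intervalIntegrable_iff_integrableOn_Ioc_of_le zero_le_one] at this
      exact this.const_mul _
    have hval : ∫ z in Set.Ioc (0 : ℝ) 1, B * z ^ (q - p - 1) = B / (q - p) := by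
      rw [← intervalIntegral.integral_of_le zero_le_one, intervalIntegral.integral_const_mul,
        integral_rpow (Or.inl (by linarith)), sub_add_cancel, Real.zero_rpow (by linarith)]
      simp [div_eq_mul_inv]
    rw [← hval, ofReal_integral_eq_lintegral_ofReal hi]
    · refine setLIntegral_mono' measurableSet_Ioc fun z hz => ENNReal.ofReal_le_ofReal ?_
      calc _ ≤ B * z ^ q * z ^ (-1 - p) :=
            mul_le_mul_of_nonneg_right (h z hz.1 hz.2) (Real.rpow_nonneg hz.1.le _)
        _ = _ := by
            rw [mul_assoc, ← Real.rpow_add hz.1]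
            ring_nf
    · filter_upwards [ae_restrict_mem measurableSet_Ioc] with z hz
      exact mul_nonneg hB (Real.rpow_nonneg hz.1.le _)
  have h2 : ∫⁻ z in Set.Ioi (1 : ℝ), ENNReal.ofReal ((1 - (charFun ν z).re) * z ^ (-1 - p)) ≤
      ENNReal.ofReal (2 / p) := by
    have hi : IntegrableOn (fun z : ℝ => 2 * z ^ (-1 - p)) (Set.Ioi 1) :=
      (integrableOn_Ioi_rpow_of_lt (by linarith) one_pos).const_mul _
    have hval : ∫ z in Set.Ioi (1 : ℝ), 2 * z ^ (-1 - p) = 2 / p := by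
      rw [integral_const_mul, integral_Ioi_rpow_of_lt (by linarith) one_pos, Real.one_rpow,
        show -1 - p + 1 = -p by ring]
      field_simp
    rw [← hval, ofReal_integral_eq_lintegral_ofReal hi]
    · refine setLIntegral_mono' measurableSet_Ioi fun z hz => ENNReal.ofReal_le_ofReal ?_
      refine mul_le_mul_of_nonneg_right ?_
        (Real.rpow_nonneg (zero_le_one.trans (le_of_lt hz)) _)
      have := (Complex.abs_re_le_norm (charFun ν z)).trans (norm_charFun_le_one z)
      linarith [neg_le_of_abs_le this]
    · filter_upwards [ae_restrict_mem measurableSet_Ioi] with z hz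
      exact mul_nonneg zero_le_two (Real.rpow_nonneg (zero_le_one.trans (le_of_lt hz)) _)
  calc ∫⁻ y, ENNReal.ofReal (cosConst p * |y| ^ p) ∂ν
      ≤ ∫⁻ y, (∫⁻ z in Set.Ioi (0 : ℝ),
          ENNReal.ofReal ((1 - Real.cos (z * y)) * z ^ (-1 - p))) ∂ν :=
        lintegral_mono fun y => cosConst_mul_rpow_le_lintegral hp y
    _ = ∫⁻ z in Set.Ioi (0 : ℝ), ∫⁻ y,
          ENNReal.ofReal ((1 - Real.cos (z * y)) * z ^ (-1 - p)) ∂ν := by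
        refine lintegral_lintegral_swap (Measurable.aemeasurable ?_)
        unfold Function.uncurry
        fun_prop
    _ = ∫⁻ z in Set.Ioi (0 : ℝ), ENNReal.ofReal ((1 - (charFun ν z).re) * z ^ (-1 - p)) :=
        setLIntegral_congr_fun measurableSet_Ioi fun z hz => hinner z hz
    _ ≤ _ := by
        rw [← Set.Ioc_union_Ioi_eq_Ioi zero_le_one,
          lintegral_union measurableSet_Ioi (Set.Ioc_disjoint_Ioi le_rfl),
          ENNReal.ofReal_add (div_nonneg hB (by linarith)) (by positivity)]
        exact add_le_add h1 h2

/-! ### Identification of the law at rational times -/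

section RealLevy

variable {Ω : Type*} [MeasurableSpace Ω] {μ : Measure Ω} [IsProbabilityMeasure μ]
  {Y : ℝ≥0 → Ω → ℝ} {x : ℝ}

lemma IsLevyProcess.charFun_add (hY : IsLevyProcess Y x μ) (s r : ℝ≥0) (z : ℝ) :
    charFun (μ.map fun ω => Y (s + r) ω - Y 0 ω) z =
      charFun (μ.map fun ω => Y s ω - Y 0 ω) z * charFun (μ.map fun ω => Y r ω - Y 0 ω) z := by
  have hm : ∀ u v, Measurable (Y u - Y v) :=
    fun u v => (hY.measurable u).sub (hY.measurable v)
  have hind := hY.indep_increments.indepFun_sub_sub (r := 0) (s := s) (t := s + r)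
    zero_le le_self_add
  have h := hind.charFun_map_add_eq_mul (hm _ _).aemeasurable (hm _ _).aemeasurable
  have h1 : Y s - Y 0 + (Y (s + r) - Y s) = fun ω => Y (s + r) ω - Y 0 ω := by
    ext ω
    simp
  have h2 : μ.map (Y (s + r) - Y s) = μ.map fun ω => Y r ω - Y 0 ω := hY.stationary_increments s r
  rw [h1, h2] at h
  exact congrFun h z

lemma IsLevyProcess.charFun_nat_mul (hY : IsLevyProcess Y x μ) (s : ℝ≥0) (k : ℕ) (z : ℝ) :
    charFun (μ.map fun ω => Y (k * s) ω - Y 0 ω) z =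
      charFun (μ.map fun ω => Y s ω - Y 0 ω) z ^ k := by
  induction k with
  | zero => simp
  | succ k ih => rw [Nat.cast_add_one, add_mul, one_mul, hY.charFun_add, ih, pow_succ]

/-- A continuous `n`-th root of `exp ψ` on the half line that equals `1` at `0` is `exp (ψ / n)`. -/
lemma eq_exp_div_of_pow_eq_exp {θ ψ : ℝ → ℂ} (hθ : Continuous θ) (hψ : Continuous ψ)
    (hθ0 : θ 0 = 1) (hψ0 : ψ 0 = 0) {n : ℕ} (hn : n ≠ 0)
    (h : ∀ z, 0 ≤ z → θ z ^ n = Complex.exp (ψ z)) {z : ℝ} (hz : 0 ≤ z) :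
    θ z = Complex.exp (ψ z / n) := by
  -- The quotient `r` is continuous on the connected half line with values in the finite set of
  -- `n`-th roots of unity, hence constant, equal to `r 0 = 1`.
  set r : ℝ → ℂ := fun z => θ z * Complex.exp (-(ψ z / n)) with hr
  have hrc : Continuous r := by fun_prop
  have hroot : ∀ z, 0 ≤ z → r z ^ n = 1 := by
    intro z hz
    rw [hr]
    simp only
    rw [mul_pow, h z hz, ← Complex.exp_nat_mul, ← Complex.exp_add, mul_neg,
      mul_div_cancel₀ _ (Nat.cast_ne_zero.2 hn), add_neg_cancel, Complex.exp_zero]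
  have hfin : {w : ℂ | w ^ n = 1}.Finite := by
    refine (Polynomial.nthRootsFinset n (1 : ℂ)).finite_toSet.subset fun w hw => ?_
    exact (Polynomial.mem_nthRootsFinset (Nat.pos_of_ne_zero hn) _).2 hw
  have hsub : (r '' Set.Ici 0).Subsingleton :=
    hfin.countable.isTotallyDisconnected _ (Set.image_subset_iff.2 fun z hz => hroot z hz)
      (isPreconnected_Ici.image _ hrc.continuousOn)
  have h1 : r z = r 0 := hsub ⟨z, hz, rfl⟩ ⟨0, Set.self_mem_Ici, rfl⟩
  rw [hr] at h1
  simp only [hθ0, hψ0, zero_div, neg_zero, Complex.exp_zero, mul_one, Complex.exp_neg] at h1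
  rwa [mul_inv_eq_one₀ (Complex.exp_ne_zero _)] at h1

lemma IsLevyProcess.charFun_rat (hY : IsLevyProcess Y x μ) {ψ : ℝ → ℂ} (hψ : Continuous ψ)
    (hψ0 : ψ 0 = 0)
    (h1 : ∀ z, 0 ≤ z → charFun (μ.map fun ω => Y 1 ω - Y 0 ω) z = Complex.exp (ψ z))
    (n k : ℕ) {z : ℝ} (hz : 0 ≤ z) :
    charFun (μ.map fun ω => Y (k / (n + 1)) ω - Y 0 ω) z =
      Complex.exp (((k / (n + 1) : ℝ) : ℂ) * ψ z) := by
  have hmeas : Measurable fun ω => Y (1 / (n + 1)) ω - Y 0 ω :=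
    (hY.measurable _).sub (hY.measurable _)
  have : IsProbabilityMeasure (μ.map fun ω => Y (1 / (n + 1)) ω - Y 0 ω) :=
    Measure.isProbabilityMeasure_map hmeas.aemeasurable
  have hroot : charFun (μ.map fun ω => Y (1 / (n + 1)) ω - Y 0 ω) z =
      Complex.exp (ψ z / ((n + 1 : ℕ) : ℂ)) := by
    refine eq_exp_div_of_pow_eq_exp continuous_charFun hψ
      (by rw [charFun_zero, probReal_univ, Complex.ofReal_one]) hψ0 n.succ_ne_zero
      (fun u hu => ?_) hz
    rw [← hY.charFun_nat_mul, ← h1 u hu, Nat.cast_add_one, mul_one_div_cancel (by positivity)]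
  rw [show (k / (n + 1) : ℝ≥0) = k * (1 / (n + 1)) by rw [mul_one_div], hY.charFun_nat_mul, hroot,
    ← Complex.exp_nat_mul]
  congr 1
  push_cast
  ring

/-- The drift `m s` is removed first: in the exponent it would contribute a term of order `z`, too
large for the bound `C z ^ q` when `q > 1`. -/
lemma IsLevyProcess.lintegral_centered_rpow_le (hY : IsLevyProcess Y x μ)
    {β σ ρ m p q C : ℝ} (hσ : 0 < σ) (hβ : 0 < β) (hp : 0 < p) (hpq : p < q) (hC : 0 ≤ C)
    (hE : ∀ z : ℝ, 0 < z → z ≤ 1 → ‖stableExponent β σ ρ z‖ ≤ C * z ^ q)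
    (h1 : ∀ z, charFun (μ.map fun ω => Y 1 ω - Y 0 ω) z = stableCharFun β σ ρ m z) (n k : ℕ) :
    ∫⁻ ω, ENNReal.ofReal
        (cosConst p * |Y (k / (n + 1)) ω - Y 0 ω + -(m * (k / (n + 1)))| ^ p) ∂μ ≤
      ENNReal.ofReal (2 * (k / (n + 1)) * C / (q - p) + 2 / p) := by
  set s : ℝ := k / (n + 1) with hs
  have hs0 : 0 ≤ s := by positivity
  have hmeas : Measurable fun ω => Y (k / (n + 1)) ω - Y 0 ω :=
    (hY.measurable _).sub (hY.measurable _)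
  have hmeas' : Measurable fun ω => Y (k / (n + 1)) ω - Y 0 ω + -(m * s) := hmeas.add_const _
  have hprob : IsProbabilityMeasure (μ.map fun ω => Y (k / (n + 1)) ω - Y 0 ω + -(m * s)) :=
    Measure.isProbabilityMeasure_map hmeas'.aemeasurable
  have hchar : ∀ z, 0 ≤ z → charFun (μ.map fun ω => Y (k / (n + 1)) ω - Y 0 ω + -(m * s)) z =
      Complex.exp (s * stableExponent β σ ρ z) := by
    intro z hz
    have hmap : (μ.map fun ω => Y (k / (n + 1)) ω - Y 0 ω + -(m * s)) =
        (μ.map fun ω => Y (k / (n + 1)) ω - Y 0 ω).map (· + -(m * s)) := by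
      rw [Measure.map_map (by fun_prop) hmeas]
      rfl
    rw [hmap, charFun_map_add_const, hY.charFun_rat
      (ψ := fun z => stableExponent β σ ρ z + Complex.I * ((m * z : ℝ) : ℂ))
      ((continuous_stableExponent hβ).add (by fun_prop)) (by simp [stableExponent_zero hβ])
      (fun z hz => by rw [h1, stableCharFun_eq_exp hβ hz]) n k hz, ← Complex.exp_add]
    congr 1
    rw [real_inner_eq_re_inner, ← hs]
    simp
    ring
  have key := lintegral_rpow_le_of_charFun hp hpq (B := 2 * s * C) (by positivity)
    (μ.map fun ω => Y (k / (n + 1)) ω - Y 0 ω + -(m * s)) ?_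
  · rwa [lintegral_map (by fun_prop) hmeas'] at key
  · intro z hz0 hz1
    rw [hchar z hz0.le]
    have hre : (s * stableExponent β σ ρ z).re ≤ 0 := by
      rw [Complex.re_ofReal_mul]
      exact mul_nonpos_of_nonneg_of_nonpos hs0 (re_stableExponent_nonpos hσ hz0.le)
    calc 1 - (Complex.exp (s * stableExponent β σ ρ z)).re
        = (1 - Complex.exp (s * stableExponent β σ ρ z)).re := by simp
      _ ≤ ‖1 - Complex.exp (s * stableExponent β σ ρ z)‖ := Complex.re_le_norm _
      _ ≤ 2 * (s * (C * z ^ q)) := by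
          refine (norm_one_sub_exp_le hre).trans ?_
          rw [norm_mul, Complex.norm_real, Real.norm_of_nonneg hs0]
          have := hE z hz0 hz1
          gcongr
      _ = _ := by ring

end RealLevy

lemma add_rpow_le {p a b : ℝ} (hp0 : 0 < p) (hp2 : p ≤ 2) (ha : 0 ≤ a) (hb : 0 ≤ b) :
    (a + b) ^ p ≤ 4 * (a ^ p + b ^ p) := by
  have h2 : (2 : ℝ) ^ p ≤ 4 := by
    calc (2 : ℝ) ^ p ≤ 2 ^ (2 : ℝ) := Real.rpow_le_rpow_of_exponent_le one_le_two hp2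
      _ = 4 := by norm_num
  have ha' := Real.rpow_nonneg ha p
  have hb' := Real.rpow_nonneg hb p
  have hmax : ∀ c, 0 ≤ c → a + b ≤ 2 * c → (a + b) ^ p ≤ 4 * c ^ p := fun c hc h =>
    calc (a + b) ^ p ≤ (2 * c) ^ p := by gcongr
      _ = 2 ^ p * c ^ p := Real.mul_rpow zero_le_two hc
      _ ≤ 4 * c ^ p := by gcongr
  rcases le_total a b with h | h
  · linarith [hmax b hb (by linarith)]
  · linarith [hmax a ha (by linarith)]

lemma IsLevyProcess.coord {Ω : Type*} [MeasurableSpace Ω] {d : ℕ} {μ : Measure Ω}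
    {X : ℝ≥0 → Ω → EuclideanSpace ℝ (Fin d)} {x : EuclideanSpace ℝ (Fin d)}
    (hX : IsLevyProcess X x μ) (j : Fin d) : IsLevyProcess (fun s ω => X s ω j) (x j) μ := by
  have hproj : Continuous fun y : EuclideanSpace ℝ (Fin d) => y j := by fun_prop
  have hm : ∀ s, Measurable (X s) := hX.measurable
  refine ⟨fun s => hproj.measurable.comp (hm s), ?_, ?_, fun s r => ?_, ?_⟩
  · filter_upwards [hX.start] with ω h
    rw [h]
  · exact hX.indep_increments.map (EuclideanSpace.proj (𝕜 := ℝ) j)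
  · have h := congrArg (Measure.map fun y : EuclideanSpace ℝ (Fin d) => y j)
      (hX.stationary_increments s r)
    have hmd : ∀ u v, Measurable fun ω => X u ω - X v ω := fun u v => (hm u).sub (hm v)
    rwa [Measure.map_map hproj.measurable (hmd _ _),
      Measure.map_map hproj.measurable (hmd _ _)] at h
  · filter_upwards [hX.cadlag] with ω h s
    obtain ⟨hr, l, hl⟩ := h s
    exact ⟨hproj.continuousAt.comp_continuousWithinAt hr, l j, (hproj.tendsto l).comp hl⟩

/-- Moments of order `p < β` of the coordinates of an isotropic `β`-stable process at rational
times. -/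
lemma exists_moment_bound_stable {β σ ρ m p : ℝ} (hβ0 : 0 < β) (hβ2 : β ≤ 2) (hσ : 0 < σ)
    (hp0 : 0 < p) (hpβ : p < β) :
    ∃ K : ℝ≥0, ∀ (Ω : Type*) [MeasurableSpace Ω] (μ : Measure Ω) [IsProbabilityMeasure μ]
      (d : ℕ) (X : ℝ≥0 → Ω → EuclideanSpace ℝ (Fin d)) (x : EuclideanSpace ℝ (Fin d)),
      IsIsotropicStableProcess β σ ρ m X x μ → ∀ (j : Fin d) (n k : ℕ),
      ∫⁻ ω, ENNReal.ofReal (|X (k / (n + 1)) ω j - x j| ^ p) ∂μ ≤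
        K * (1 + ((k / (n + 1) : ℝ≥0) : ℝ≥0∞)) ^ 2 := by
  obtain ⟨C, hC0, hC⟩ := exists_norm_stableExponent_le (ρ := ρ) hσ
    (show (p + β) / 2 < β by linarith)
  -- The midpoint leaves room on both sides: `p < q` for the moment integral, `q < β` for the
  -- exponent bound.
  set q := (p + β) / 2 with hq
  have hqp : 0 < q - p := by rw [hq]; linarith
  have hcc := cosConst_pos p
  -- The first summand bounds the centred moment and the second the drift `(|m| s) ^ p`; the factor
  -- `4` comes from `add_rpow_le`.
  set A := 4 * ((2 * C / (q - p) + 2 / p) / cosConst p + (1 + |m|) ^ 2) with hA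
  have hA0 : 0 ≤ A := by positivity
  refine ⟨A.toNNReal, fun Ω _ μ _ d X x hX j n k => ?_⟩
  have hY := hX.levy.coord j
  have hcent := hY.lintegral_centered_rpow_le hσ hβ0 hp0 (by linarith) hC0 hC
    (hX.isotropic j) n k
  set s : ℝ := k / (n + 1) with hs
  have hs0 : 0 ≤ s := by positivity
  have hpt : ∀ᵐ ω ∂μ, ENNReal.ofReal (|X (k / (n + 1)) ω j - x j| ^ p) ≤
      ENNReal.ofReal (4 / cosConst p) * ENNReal.ofReal
        (cosConst p * |X (k / (n + 1)) ω j - X 0 ω j + -(m * s)| ^ p) +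
        ENNReal.ofReal (4 * ((1 + |m|) ^ 2 * (1 + s) ^ 2)) := by
    filter_upwards [hY.start] with ω h0
    rw [h0, ← ENNReal.ofReal_mul (by positivity), ← ENNReal.ofReal_add (by positivity)
      (by positivity)]
    apply ENNReal.ofReal_le_ofReal
    set u := X (k / (n + 1)) ω j - x j with hu
    have h1 : |u| ≤ |u + -(m * s)| + |m| * s := by
      have := abs_add_le (u + -(m * s)) (m * s)
      rwa [abs_mul m s, abs_of_nonneg hs0, neg_add_cancel_right] at this
    have h2 : (|m| * s) ^ p ≤ (1 + |m|) ^ 2 * (1 + s) ^ 2 := by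
      have hms : |m| * s ≤ (1 + |m|) * (1 + s) := by nlinarith [abs_nonneg m]
      have h1' : 1 ≤ (1 + |m|) * (1 + s) := by nlinarith [abs_nonneg m]
      calc (|m| * s) ^ p ≤ ((1 + |m|) * (1 + s)) ^ p := by gcongr
        _ ≤ ((1 + |m|) * (1 + s)) ^ (2 : ℝ) :=
            Real.rpow_le_rpow_of_exponent_le h1' (by linarith)
        _ = _ := by rw [Real.rpow_two, mul_pow]
    calc |u| ^ p ≤ (|u + -(m * s)| + |m| * s) ^ p := by gcongr
      _ ≤ 4 * (|u + -(m * s)| ^ p + (|m| * s) ^ p) :=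
          add_rpow_le hp0 (by linarith) (abs_nonneg _) (by positivity)
      _ ≤ 4 * (|u + -(m * s)| ^ p + (1 + |m|) ^ 2 * (1 + s) ^ 2) := by gcongr
      _ = _ := by field_simp
  have hscast : ((k / (n + 1) : ℝ≥0) : ℝ≥0∞) = ENNReal.ofReal s := by
    rw [ENNReal.ofReal, ENNReal.coe_inj]
    apply NNReal.coe_injective
    rw [Real.coe_toNNReal _ hs0, hs]
    push_cast
    rfl
  calc _ ≤ _ := lintegral_mono_ae hpt
    _ = ENNReal.ofReal (4 / cosConst p) * ∫⁻ ω, ENNReal.ofReal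
          (cosConst p * |X (k / (n + 1)) ω j - X 0 ω j + -(m * s)| ^ p) ∂μ +
        ENNReal.ofReal (4 * ((1 + |m|) ^ 2 * (1 + s) ^ 2)) := by
        rw [lintegral_add_right _ measurable_const, lintegral_const_mul' _ _ ENNReal.ofReal_ne_top]
        simp
    _ ≤ ENNReal.ofReal (4 / cosConst p) * ENNReal.ofReal (2 * s * C / (q - p) + 2 / p) +
        ENNReal.ofReal (4 * ((1 + |m|) ^ 2 * (1 + s) ^ 2)) := by gcongr
    _ ≤ ENNReal.ofReal (A * (1 + s) ^ 2) := by
        rw [← ENNReal.ofReal_mul (by positivity), ← ENNReal.ofReal_add (by positivity)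
          (by positivity)]
        apply ENNReal.ofReal_le_ofReal
        have h1 : 2 * s * C / (q - p) + 2 / p ≤ (2 * C / (q - p) + 2 / p) * (1 + s) ^ 2 := by
          have h3 : 0 ≤ C / (q - p) := by positivity
          have h4 : 0 ≤ 2 / p := by positivity
          have h5 : 2 * s * C / (q - p) = 2 * s * (C / (q - p)) := by ring
          have h6 : 2 * C / (q - p) = 2 * (C / (q - p)) := by ring
          rw [h5, h6]
          nlinarith [mul_nonneg hs0 h3, mul_nonneg hs0 h4, mul_nonneg (sq_nonneg s) h3,
            mul_nonneg (sq_nonneg s) h4]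
        calc _ ≤ 4 / cosConst p * ((2 * C / (q - p) + 2 / p) * (1 + s) ^ 2) +
              4 * ((1 + |m|) ^ 2 * (1 + s) ^ 2) := by gcongr
          _ = _ := by rw [hA]; ring
    _ = _ := by
        rw [ENNReal.ofReal_mul hA0, ENNReal.ofReal_pow (by positivity),
          ENNReal.ofReal_add zero_le_one hs0, ENNReal.ofReal_one, hscast]
        rfl

end StableMoments

/-! ### Evaluation at an independent random time -/

section RandomTime

variable {Ω E : Type*} [MeasurableSpace Ω] {μ : Measure Ω}

lemma measurable_eval_nat [MeasurableSpace E] {N : Ω → ℕ} (hN : Measurable N) {V : ℕ → Ω → E}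
    (hV : ∀ k, Measurable (V k)) : Measurable fun ω => V (N ω) ω := by
  have h : Measurable fun q : ℕ × Ω => V q.1 q.2 := measurable_from_prod_countable_right hV
  exact h.comp (hN.prodMk measurable_id)

/-- Conditioning on `N` by hand: on each event `N = k` the integral factorizes by independence. -/
lemma lintegral_eval_nat_le {N : Ω → ℕ} (hN : Measurable N) {V : ℕ → Ω → ℝ≥0∞}
    (hV : ∀ k, Measurable (V k)) (hind : ∀ k, IndepFun (V k) N μ) {G : ℕ → ℝ≥0∞}
    (hG : ∀ k, ∫⁻ ω, V k ω ∂μ ≤ G k) :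
    ∫⁻ ω, V (N ω) ω ∂μ ≤ ∫⁻ ω, G (N ω) ∂μ := by
  have hone : ∀ k : ℕ, Measurable fun n : ℕ => if n = k then (1 : ℝ≥0∞) else 0 :=
    fun k => measurable_of_countable _
  have hsum : ∀ (F : ℕ → ℝ≥0∞) (n : ℕ), F n = ∑' k, F k * if n = k then 1 else 0 := by
    intro F n
    rw [tsum_eq_single n fun k hk => by rw [if_neg hk.symm, mul_zero], if_pos rfl, mul_one]
  calc ∫⁻ ω, V (N ω) ω ∂μ = ∫⁻ ω, ∑' k, V k ω * (if N ω = k then 1 else 0) ∂μ :=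
        lintegral_congr fun ω => hsum (fun k => V k ω) (N ω)
    _ = ∑' k, ∫⁻ ω, V k ω * (if N ω = k then 1 else 0) ∂μ :=
        lintegral_tsum fun k => ((hV k).mul ((hone k).comp hN)).aemeasurable
    _ = ∑' k, (∫⁻ ω, V k ω ∂μ) * ∫⁻ ω, (if N ω = k then 1 else 0) ∂μ := by
        congr 1
        ext k
        exact lintegral_mul_eq_lintegral_mul_lintegral_of_indepFun (hV k) ((hone k).comp hN)
          ((hind k).comp measurable_id (hone k))
    _ ≤ ∑' k, G k * ∫⁻ ω, (if N ω = k then 1 else 0) ∂μ := by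
        gcongr with k
        exact hG k
    _ = ∑' k, ∫⁻ ω, G k * (if N ω = k then 1 else 0) ∂μ := by
        congr 1
        ext k
        exact (lintegral_const_mul _ ((hone k).comp hN)).symm
    _ = ∫⁻ ω, ∑' k, G k * (if N ω = k then 1 else 0) ∂μ :=
        (lintegral_tsum fun k => (((hone k).comp hN).const_mul _).aemeasurable).symm
    _ = ∫⁻ ω, G (N ω) ∂μ := lintegral_congr fun ω => (hsum G (N ω)).symm

/-- The smallest point of the grid `ℕ / (n + 1)` lying strictly to the right of `s`. -/
def gridAbove (n : ℕ) (s : ℝ≥0) : ℝ≥0 := ((⌊s * (n + 1)⌋₊ + 1 : ℕ) : ℝ≥0) / (n + 1)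

lemma le_gridAbove (n : ℕ) (s : ℝ≥0) : s ≤ gridAbove n s := by
  rw [gridAbove, le_div_iff₀ (by positivity)]
  exact_mod_cast (Nat.lt_floor_add_one (s * (n + 1))).le

lemma gridAbove_le_add (n : ℕ) (s : ℝ≥0) : gridAbove n s ≤ s + 1 / (n + 1) := by
  rw [gridAbove, div_le_iff₀ (by positivity), add_mul, one_div_mul_cancel (by positivity)]
  push_cast
  gcongr
  exact Nat.floor_le zero_le

lemma gridAbove_le_add_one (n : ℕ) (s : ℝ≥0) : gridAbove n s ≤ s + 1 := by
  refine (gridAbove_le_add n s).trans (add_le_add_right ?_ s)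
  exact div_le_one_of_le₀ le_add_self zero_le

lemma tendsto_gridAbove (s : ℝ≥0) : Tendsto (fun n => gridAbove n s) atTop (𝓝 s) := by
  have h : Tendsto (fun n : ℕ => s + 1 / ((n : ℝ≥0) + 1)) atTop (𝓝 s) := by
    simpa using tendsto_const_nhds (x := s).add (tendsto_one_div_add_atTop_nhds_zero_nat (𝕜 := ℝ≥0))
  exact tendsto_of_tendsto_of_tendsto_of_le_of_le tendsto_const_nhds h
    (fun n => le_gridAbove n s) (fun n => gridAbove_le_add n s)

lemma tendsto_gridAbove_path {Ω E : Type*} [TopologicalSpace E] {X : ℝ≥0 → Ω → E} {T : Ω → ℝ≥0}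
    {ω : Ω}
    (h : ∀ s, ContinuousWithinAt (fun s => X s ω) (Set.Ici s) s) :
    Tendsto (fun n => X (gridAbove n (T ω)) ω) atTop (𝓝 (X (T ω) ω)) :=
  (h (T ω)).tendsto.comp (tendsto_nhdsWithin_iff.2
    ⟨tendsto_gridAbove _, Eventually.of_forall fun n => le_gridAbove n _⟩)

lemma measurable_floor_mul {T : Ω → ℝ≥0} (hT : Measurable T) (n : ℕ) :
    Measurable fun ω => ⌊T ω * ((n : ℝ≥0) + 1)⌋₊ :=
  Nat.measurable_floor.comp (hT.mul_const _)

lemma measurable_eval_gridAbove [MeasurableSpace E] {X : ℝ≥0 → Ω → E} {T : Ω → ℝ≥0}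
    (hX : ∀ s, Measurable (X s)) (hT : Measurable T) (n : ℕ) :
    Measurable fun ω => X (gridAbove n (T ω)) ω :=
  measurable_eval_nat (V := fun k => X (((k + 1 : ℕ) : ℝ≥0) / (n + 1)))
    (measurable_floor_mul hT n) fun _ => hX _

variable [TopologicalSpace E] [MeasurableSpace E] [BorelSpace E] {X : ℝ≥0 → Ω → E} {T : Ω → ℝ≥0}

lemma aemeasurable_eval_time [TopologicalSpace.PseudoMetrizableSpace E]
    (hX : ∀ s, Measurable (X s))
    (hc : ∀ᵐ ω ∂μ, ∀ s, ContinuousWithinAt (fun s => X s ω) (Set.Ici s) s) (hT : Measurable T) :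
    AEMeasurable (fun ω => X (T ω) ω) μ :=
  aemeasurable_of_tendsto_metrizable_ae atTop
    (fun n => (measurable_eval_gridAbove hX hT n).aemeasurable)
    (hc.mono fun _ h => tendsto_gridAbove_path h)

/-- Moment bounds at rational times carry over to independent random times. -/
lemma lintegral_eval_time_le (hX : ∀ s, Measurable (X s))
    (hc : ∀ᵐ ω ∂μ, ∀ s, ContinuousWithinAt (fun s => X s ω) (Set.Ici s) s) (hT : Measurable T)
    (hind : IndepFun (fun ω s => X s ω) T μ) {f : E → ℝ≥0∞} (hf : Continuous f)
    {G : ℝ≥0 → ℝ≥0∞} (hG : Monotone G)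
    (hrat : ∀ n k : ℕ, ∫⁻ ω, f (X (k / (n + 1)) ω) ∂μ ≤ G (k / (n + 1))) :
    ∫⁻ ω, f (X (T ω) ω) ∂μ ≤ ∫⁻ ω, G (T ω + 1) ∂μ := by
  have hgrid : ∀ n : ℕ, ∫⁻ ω, f (X (gridAbove n (T ω)) ω) ∂μ ≤ ∫⁻ ω, G (T ω + 1) ∂μ := by
    intro n
    have hfl : Measurable fun s : ℝ≥0 => ⌊s * ((n : ℝ≥0) + 1)⌋₊ :=
      Nat.measurable_floor.comp (measurable_id.mul_const _)
    calc ∫⁻ ω, f (X (gridAbove n (T ω)) ω) ∂μ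
        ≤ ∫⁻ ω, G (gridAbove n (T ω)) ∂μ :=
          lintegral_eval_nat_le (N := fun ω => ⌊T ω * ((n : ℝ≥0) + 1)⌋₊)
            (V := fun k ω => f (X (((k + 1 : ℕ) : ℝ≥0) / (n + 1)) ω))
            (G := fun k => G (((k + 1 : ℕ) : ℝ≥0) / (n + 1)))
            (measurable_floor_mul hT n) (fun k => hf.measurable.comp (hX _))
            (fun k => hind.comp (hf.measurable.comp (measurable_pi_apply _)) hfl)
            (fun k => hrat n (k + 1))
      _ ≤ _ := lintegral_mono fun ω => hG (gridAbove_le_add_one n (T ω))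
  -- The grid times decrease to `T` from the right up to `1 / (n + 1)`, so right-continuity gives
  -- pointwise convergence and Fatou's lemma passes the bound to the limit.
  calc ∫⁻ ω, f (X (T ω) ω) ∂μ
      = ∫⁻ ω, liminf (fun n => f (X (gridAbove n (T ω)) ω)) atTop ∂μ := by
        refine lintegral_congr_ae (hc.mono fun ω h => ?_)
        exact (((hf.tendsto _).comp (tendsto_gridAbove_path h)).liminf_eq).symm
    _ ≤ liminf (fun n => ∫⁻ ω, f (X (gridAbove n (T ω)) ω) ∂μ) atTop :=
        lintegral_liminf_le fun n => hf.measurable.comp (measurable_eval_gridAbove hX hT n)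
    _ ≤ _ := liminf_le_of_le (by isBoundedDefault) fun b hb => by
        obtain ⟨n, hn⟩ := hb.exists
        exact hn.trans (hgrid n)

lemma lintegral_eval_const_le [IsProbabilityMeasure μ] (hX : ∀ s, Measurable (X s))
    (hc : ∀ᵐ ω ∂μ, ∀ s, ContinuousWithinAt (fun s => X s ω) (Set.Ici s) s)
    {f : E → ℝ≥0∞} (hf : Continuous f) {G : ℝ≥0 → ℝ≥0∞} (hG : Monotone G)
    (hrat : ∀ n k : ℕ, ∫⁻ ω, f (X (k / (n + 1)) ω) ∂μ ≤ G (k / (n + 1))) (s : ℝ≥0) :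
    ∫⁻ ω, f (X s ω) ∂μ ≤ G (s + 1) := by
  simpa using lintegral_eval_time_le (T := fun _ => s) hX hc measurable_const
    (indepFun_const_right _ s) hf hG hrat

/-- Cauchy-Schwarz costs a factor equal to the number of terms, and one factor `h` turns this number
into at most `T`. -/
lemma sq_riemann_sum_le {h T : ℝ≥0} (hh : 0 < h) (v : ℕ → ℝ) :
    (∑ i ∈ Finset.Icc 1 ⌊T / h⌋₊, (h : ℝ) * v i) ^ 2 ≤
      ∑ i ∈ Finset.Icc 1 ⌊T / h⌋₊, (T : ℝ) * h * v i ^ 2 := by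
  have hN : (⌊T / h⌋₊ : ℝ) * h ≤ T := by
    have h1 : (⌊T / h⌋₊ : ℝ≥0) * h ≤ T := (le_div_iff₀ hh).1 (Nat.floor_le zero_le)
    exact_mod_cast h1
  calc (∑ i ∈ Finset.Icc 1 ⌊T / h⌋₊, (h : ℝ) * v i) ^ 2
      ≤ (Finset.Icc 1 ⌊T / h⌋₊).card * ∑ i ∈ Finset.Icc 1 ⌊T / h⌋₊, ((h : ℝ) * v i) ^ 2 :=
        sq_sum_le_card_mul_sum_sq
    _ = ∑ i ∈ Finset.Icc 1 ⌊T / h⌋₊, (⌊T / h⌋₊ * h : ℝ) * h * v i ^ 2 := by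
        rw [Nat.card_Icc, Nat.add_sub_cancel, Finset.mul_sum]
        exact Finset.sum_congr rfl fun i _ => by ring
    _ ≤ _ := by gcongr

/-- Second moment of a Riemann sum of a functional of `X` up to an independent random time. -/
lemma lintegral_sq_riemann_sum_le (hX : ∀ s, Measurable (X s)) (hT : Measurable T)
    (hind : IndepFun (fun ω s => X s ω) T μ) {g : E → ℝ} (hg : Continuous g)
    {G : ℝ≥0 → ℝ≥0∞} (hG : Monotone G)
    (hs : ∀ s, ∫⁻ ω, ENNReal.ofReal (g (X s ω) ^ 2) ∂μ ≤ G s) {h : ℝ≥0} (hh : 0 < h) :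
    ∫⁻ ω, ENNReal.ofReal ((∑ i ∈ Finset.Icc 1 ⌊T ω / h⌋₊,
        (h : ℝ) * g (X (((i - 1 : ℕ) : ℝ≥0) * h) ω)) ^ 2) ∂μ ≤
      ∫⁻ ω, (T ω : ℝ≥0∞) ^ 2 * G (T ω) ∂μ := by
  -- The weight moves the random number of terms into a factor depending on `T` alone. Each term of
  -- the resulting series then splits by independence.
  set w : ℕ → ℝ≥0 → ℝ≥0∞ := fun i s => if i ∈ Finset.Icc 1 ⌊s / h⌋₊ then (s : ℝ≥0∞) * h else 0
    with hw
  have hwm : ∀ i, Measurable (w i) := by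
    intro i
    refine Measurable.ite ?_ (by fun_prop) measurable_const
    exact (Nat.measurable_floor.comp (measurable_id.div_const h))
      (MeasurableSet.of_discrete (s := {n : ℕ | i ∈ Finset.Icc 1 n}))
  have hgm : ∀ s, Measurable fun ω => ENNReal.ofReal (g (X s ω) ^ 2) :=
    fun s => (ENNReal.continuous_ofReal.comp (hg.pow 2)).measurable.comp (hX s)
  have hsum : ∀ (F : ℕ → ℝ≥0∞) (s : ℝ≥0),
      ∑' i, w i s * F i = ∑ i ∈ Finset.Icc 1 ⌊s / h⌋₊, (s : ℝ≥0∞) * h * F i := by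
    intro F s
    rw [tsum_eq_sum (s := Finset.Icc 1 ⌊s / h⌋₊) fun i hi => by simp only [hw, if_neg hi, zero_mul]]
    exact Finset.sum_congr rfl fun i hi => by simp only [hw, if_pos hi]
  calc _ ≤ ∫⁻ ω, ∑' i : ℕ, w i (T ω) *
        ENNReal.ofReal (g (X (((i - 1 : ℕ) : ℝ≥0) * h) ω) ^ 2) ∂μ := by
        refine lintegral_mono fun ω => ?_
        rw [hsum]
        refine (ENNReal.ofReal_le_ofReal (sq_riemann_sum_le hh _)).trans ?_
        rw [ENNReal.ofReal_sum_of_nonneg fun i _ => by positivity]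
        refine Finset.sum_le_sum fun i _ => ?_
        rw [ENNReal.ofReal_mul (by positivity), ENNReal.ofReal_mul (by positivity),
          ENNReal.ofReal_coe_nnreal, ENNReal.ofReal_coe_nnreal]
    _ = ∑' i : ℕ, ∫⁻ ω, w i (T ω) *
        ENNReal.ofReal (g (X (((i - 1 : ℕ) : ℝ≥0) * h) ω) ^ 2) ∂μ :=
        lintegral_tsum fun i => (((hwm i).comp hT).mul (hgm _)).aemeasurable
    _ = ∑' i : ℕ, (∫⁻ ω, w i (T ω) ∂μ) *
        ∫⁻ ω, ENNReal.ofReal (g (X (((i - 1 : ℕ) : ℝ≥0) * h) ω) ^ 2) ∂μ := by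
        congr 1
        ext i
        refine lintegral_mul_eq_lintegral_mul_lintegral_of_indepFun ((hwm i).comp hT) (hgm _) ?_
        exact hind.symm.comp (hwm i)
          ((ENNReal.continuous_ofReal.comp (hg.pow 2)).measurable.comp (measurable_pi_apply _))
    _ ≤ ∑' i : ℕ, (∫⁻ ω, w i (T ω) ∂μ) * G (((i - 1 : ℕ) : ℝ≥0) * h) := by
        gcongr with i
        exact hs _
    _ = ∑' i : ℕ, ∫⁻ ω, w i (T ω) * G (((i - 1 : ℕ) : ℝ≥0) * h) ∂μ := by
        congr 1
        ext i
        exact (lintegral_mul_const _ ((hwm i).comp hT)).symm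
    _ = ∫⁻ ω, ∑' i : ℕ, w i (T ω) * G (((i - 1 : ℕ) : ℝ≥0) * h) ∂μ :=
        (lintegral_tsum fun i => (((hwm i).comp hT).mul_const _).aemeasurable).symm
    _ ≤ _ := by
        refine lintegral_mono fun ω => ?_
        rw [hsum]
        set s := T ω with hs_def
        have hN : (⌊s / h⌋₊ : ℝ≥0) * h ≤ s := (le_div_iff₀ hh).1 (Nat.floor_le zero_le)
        calc _ ≤ ∑ i ∈ Finset.Icc 1 ⌊s / h⌋₊, (s : ℝ≥0∞) * h * G s := by
              refine Finset.sum_le_sum fun i hi => ?_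
              gcongr
              -- Every sampling time satisfies `(i - 1) h ≤ ⌊s / h⌋ h ≤ s`, so `G s` dominates all
              -- terms.
              refine hG (le_trans ?_ hN)
              gcongr
              exact (Nat.sub_le _ _).trans (Finset.mem_Icc.1 hi).2
          _ = (s : ℝ≥0∞) * (((⌊s / h⌋₊ : ℝ≥0) * h : ℝ≥0) : ℝ≥0∞) * G s := by
              rw [Finset.sum_const, Nat.card_Icc, Nat.add_sub_cancel, nsmul_eq_mul]
              push_cast
              ring
          _ ≤ (s : ℝ≥0∞) * s * G s := by gcongr
          _ = _ := by rw [sq]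

end RandomTime

/-! ### Growth of `φ` and `g` -/

section Growth

variable {d : ℕ}

lemma sum_rpow_le {ι : Type*} (s : Finset ι) {p : ℝ} (hp0 : 0 < p) (hp2 : p ≤ 2) {v : ι → ℝ}
    (hv : ∀ i, 0 ≤ v i) : (∑ i ∈ s, v i) ^ p ≤ 4 ^ s.card * ∑ i ∈ s, v i ^ p := by
  induction s using Finset.cons_induction with
  | empty => simp [Real.zero_rpow hp0.ne']
  | cons i s hi ih =>
    rw [Finset.sum_cons, Finset.sum_cons, Finset.card_cons]
    have h1 : (1 : ℝ) ≤ 4 ^ s.card := one_le_pow₀ (by norm_num)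
    have h2 : 0 ≤ v i ^ p := Real.rpow_nonneg (hv i) p
    calc (v i + ∑ j ∈ s, v j) ^ p ≤ 4 * (v i ^ p + (∑ j ∈ s, v j) ^ p) :=
          add_rpow_le hp0 hp2 (hv i) (Finset.sum_nonneg fun j _ => hv j)
      _ ≤ 4 * (4 ^ s.card * v i ^ p + 4 ^ s.card * ∑ j ∈ s, v j ^ p) := by
          gcongr
          exact le_mul_of_one_le_left h2 h1
      _ = _ := by ring

lemma norm_le_sum_abs (u : EuclideanSpace ℝ (Fin d)) : ‖u‖ ≤ ∑ j, |u j| := by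
  rw [EuclideanSpace.norm_eq]
  refine Real.sqrt_le_iff.2 ⟨Finset.sum_nonneg fun j _ => abs_nonneg _, ?_⟩
  exact Finset.sum_sq_le_sq_sum_of_nonneg fun j _ => abs_nonneg _

lemma rpow_le_one_add_rpow {u r p : ℝ} (hu : 0 ≤ u) (hr : 0 ≤ r) (hrp : r ≤ p) :
    u ^ r ≤ 1 + u ^ p := by
  have hp := Real.rpow_nonneg hu p
  rcases le_total u 1 with h | h
  · linarith [Real.rpow_le_one hu h hr]
  · linarith [Real.rpow_le_rpow_of_exponent_le h hrp]

lemma norm_rpow_le (x y : EuclideanSpace ℝ (Fin d)) {p : ℝ} (hp0 : 0 < p) (hp2 : p ≤ 2) :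
    ‖y‖ ^ p ≤ 4 * (‖x‖ ^ p + 4 ^ d * ∑ j, |y j - x j| ^ p) := by
  have h1 : ‖y‖ ≤ ‖x‖ + ∑ j, |y j - x j| := by
    have := norm_add_le x (y - x)
    rw [add_sub_cancel] at this
    exact this.trans (add_le_add_right (norm_le_sum_abs (y - x)) _)
  calc ‖y‖ ^ p ≤ (‖x‖ + ∑ j, |y j - x j|) ^ p := by gcongr
    _ ≤ 4 * (‖x‖ ^ p + (∑ j, |y j - x j|) ^ p) :=
        add_rpow_le hp0 hp2 (norm_nonneg _) (Finset.sum_nonneg fun j _ => abs_nonneg _)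
    _ ≤ _ := by
        gcongr
        simpa using sum_rpow_le Finset.univ hp0 hp2 (v := fun j => |y j - x j|)
          fun j => abs_nonneg _

/-- `f ^ 2` grows at most like `∑ j, |y_j - x_j| ^ p`. -/
def HasSqGrowth (p : ℝ) (x : EuclideanSpace ℝ (Fin d)) (f : EuclideanSpace ℝ (Fin d) → ℝ) : Prop :=
  ∃ C : ℝ, 0 ≤ C ∧ ∀ y, f y ^ 2 ≤ C * (1 + ∑ j, |y j - x j| ^ p)

lemma sum_rpow_nonneg (x y : EuclideanSpace ℝ (Fin d)) (p : ℝ) : 0 ≤ ∑ j, |y j - x j| ^ p :=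
  Finset.sum_nonneg fun _ _ => Real.rpow_nonneg (abs_nonneg _) _

/-- Continuity bounds `φ` on a compact set, the growth hypothesis bounds it outside, and `2 q ≤ p`
lets the square be absorbed. -/
lemma hasSqGrowth_of_isBigO {φ : EuclideanSpace ℝ (Fin d) → ℝ} (hφ : Continuous φ) {q p : ℝ}
    (hφO : φ =O[cocompact (EuclideanSpace ℝ (Fin d))] fun y => ‖y‖ ^ q) (hq : 0 < q)
    (hqp : 2 * q ≤ p) (hp2 : p ≤ 2) (x : EuclideanSpace ℝ (Fin d)) : HasSqGrowth p x φ := by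
  obtain ⟨c, hc0, hc⟩ := hφO.exists_pos
  obtain ⟨S, hS, hSc⟩ := mem_cocompact.1 hc.bound
  obtain ⟨B, hB⟩ := hS.exists_bound_of_continuousOn hφ.continuousOn
  have hφb : ∀ y, |φ y| ≤ (|B| + c) * (1 + ‖y‖ ^ q) := by
    intro y
    have hy : 0 ≤ ‖y‖ ^ q := Real.rpow_nonneg (norm_nonneg _) _
    by_cases h : y ∈ S
    · have h1 : |φ y| ≤ |B| := (hB y h).trans (le_abs_self B)
      nlinarith [abs_nonneg B]
    · have h1 : ‖φ y‖ ≤ c * ‖‖y‖ ^ q‖ := hSc h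
      rw [Real.norm_eq_abs, Real.norm_of_nonneg hy] at h1
      nlinarith [abs_nonneg B, mul_nonneg (abs_nonneg B) hy]
  have hx : 0 ≤ ‖x‖ ^ p := Real.rpow_nonneg (norm_nonneg _) _
  have h4 : (1 : ℝ) ≤ 4 ^ d := one_le_pow₀ (by norm_num)
  refine ⟨2 * (|B| + c) ^ 2 * (2 + 4 * ‖x‖ ^ p + 4 * 4 ^ d), by positivity, fun y => ?_⟩
  have hS0 := sum_rpow_nonneg x y p
  have h1 : (1 + ‖y‖ ^ q) ^ 2 ≤ 2 * (2 + ‖y‖ ^ p) := by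
    have h2 : (‖y‖ ^ q) ^ 2 ≤ 1 + ‖y‖ ^ p := by
      rw [← Real.rpow_natCast, ← Real.rpow_mul (norm_nonneg _)]
      refine rpow_le_one_add_rpow (norm_nonneg _) (by positivity) ?_
      push_cast
      linarith
    nlinarith [sq_nonneg (1 - ‖y‖ ^ q)]
  calc φ y ^ 2 = |φ y| ^ 2 := (sq_abs _).symm
    _ ≤ ((|B| + c) * (1 + ‖y‖ ^ q)) ^ 2 := by
        gcongr
        exact hφb y
    _ = (|B| + c) ^ 2 * (1 + ‖y‖ ^ q) ^ 2 := mul_pow _ _ _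
    _ ≤ (|B| + c) ^ 2 * (2 * (2 + 4 * (‖x‖ ^ p + 4 ^ d * ∑ j, |y j - x j| ^ p))) := by
        gcongr
        refine h1.trans ?_
        gcongr
        exact norm_rpow_le x y (by linarith) hp2
    _ = 2 * (|B| + c) ^ 2 * (2 + 4 * ‖x‖ ^ p + 4 * 4 ^ d * ∑ j, |y j - x j| ^ p) := by ring
    _ ≤ 2 * (|B| + c) ^ 2 * ((2 + 4 * ‖x‖ ^ p + 4 * 4 ^ d) * (1 + ∑ j, |y j - x j| ^ p)) := by
        gcongr
        nlinarith [mul_nonneg hx hS0]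
    _ = _ := by ring

lemma hasSqGrowth_of_holder {g : EuclideanSpace ℝ (Fin d) → ℝ} {γ L p : ℝ} (hγ0 : 0 < γ)
    (hγp : 2 * γ ≤ p) (hg : ∀ y z, |g y - g z| ≤ L * gammaNorm γ (y - z))
    (x : EuclideanSpace ℝ (Fin d)) : HasSqGrowth p x g := by
  refine ⟨2 * g x ^ 2 + 2 * (L ^ 2 * (d * (d + 1))), by positivity, fun y => ?_⟩
  have hS0 := sum_rpow_nonneg x y p
  have h1 : gammaNorm γ (y - x) ^ 2 ≤ d * (d + ∑ j, |y j - x j| ^ p) := by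
    calc gammaNorm γ (y - x) ^ 2 ≤ d * ∑ j, (|y j - x j| ^ γ) ^ 2 := by
          simpa [gammaNorm] using sq_sum_le_card_mul_sum_sq (s := Finset.univ)
            (f := fun j => |y j - x j| ^ γ)
      _ ≤ d * ∑ j, (1 + |y j - x j| ^ p) := by
          gcongr with j
          rw [← Real.rpow_natCast, ← Real.rpow_mul (abs_nonneg _)]
          refine rpow_le_one_add_rpow (abs_nonneg _) (by positivity) ?_
          push_cast
          linarith
      _ = _ := by simp [Finset.sum_add_distrib]
  have h2 : (g y - g x) ^ 2 ≤ L ^ 2 * gammaNorm γ (y - x) ^ 2 := by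
    rw [← sq_abs (g y - g x), ← mul_pow]
    gcongr
    exact hg y x
  have h3 : (d : ℝ) * (d + ∑ j, |y j - x j| ^ p) ≤
      d * (d + 1) * (1 + ∑ j, |y j - x j| ^ p) := by
    rw [mul_assoc]
    gcongr
    have hd : (0 : ℝ) ≤ d := Nat.cast_nonneg d
    nlinarith [mul_nonneg hd hS0]
  have h4 : L ^ 2 * gammaNorm γ (y - x) ^ 2 ≤
      L ^ 2 * (d * (d + 1) * (1 + ∑ j, |y j - x j| ^ p)) := by
    gcongr
    exact h1.trans h3
  -- The first hint is `g y ^ 2 ≤ 2 (g y - g x) ^ 2 + 2 g x ^ 2` in disguise.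
  nlinarith [sq_nonneg (g y - 2 * g x), mul_nonneg (sq_nonneg (g x)) hS0]

lemma continuous_of_holder {g : EuclideanSpace ℝ (Fin d) → ℝ} {γ L : ℝ} (hγ0 : 0 < γ)
    (hg : ∀ y z, |g y - g z| ≤ L * gammaNorm γ (y - z)) : Continuous g := by
  refine continuous_iff_continuousAt.2 fun z => tendsto_iff_norm_sub_tendsto_zero.2 ?_
  have hc : Continuous fun y : EuclideanSpace ℝ (Fin d) => L * gammaNorm γ (y - z) := by
    unfold gammaNorm
    refine continuous_const.mul (continuous_finsetSum _ fun j _ => ?_)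
    exact (Continuous.abs (by fun_prop)).rpow_const fun _ => Or.inr hγ0.le
  have h0 : L * gammaNorm γ (z - z) = 0 := by simp [gammaNorm, Real.zero_rpow hγ0.ne']
  have ht := hc.tendsto z
  rw [h0] at ht
  exact squeeze_zero (fun _ => norm_nonneg _) (fun y => hg y z) ht

lemma exists_sq_moment_bound {β σ ρ m p : ℝ} (hβ0 : 0 < β) (hβ2 : β ≤ 2) (hσ : 0 < σ)
    (hp0 : 0 < p) (hpβ : p < β) {x : EuclideanSpace ℝ (Fin d)}
    {f : EuclideanSpace ℝ (Fin d) → ℝ} (hf : HasSqGrowth p x f) :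
    ∃ K : ℝ≥0, ∀ (Ω : Type*) [MeasurableSpace Ω] (μ : Measure Ω) [IsProbabilityMeasure μ]
      (X : ℝ≥0 → Ω → EuclideanSpace ℝ (Fin d)),
      IsIsotropicStableProcess β σ ρ m X x μ → ∀ n k : ℕ,
      ∫⁻ ω, ENNReal.ofReal (f (X (k / (n + 1)) ω) ^ 2) ∂μ ≤
        K * (1 + ((k / (n + 1) : ℝ≥0) : ℝ≥0∞)) ^ 2 := by
  obtain ⟨C, hC0, hC⟩ := hf
  obtain ⟨K, hK⟩ := exists_moment_bound_stable (ρ := ρ) (m := m) hβ0 hβ2 hσ hp0 hpβ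
  refine ⟨C.toNNReal * (1 + d * K), fun Ω _ μ _ X hX n k => ?_⟩
  set s : ℝ≥0 := k / (n + 1) with hs
  have hm : ∀ j, Measurable fun ω => ENNReal.ofReal (|X s ω j - x j| ^ p) := by
    intro j
    have h : Measurable fun u : ℝ => ENNReal.ofReal (|u - x j| ^ p) := by fun_prop
    exact h.comp ((hX.levy.coord j).measurable s)
  have hone : (1 : ℝ≥0∞) ≤ (1 + (s : ℝ≥0∞)) ^ 2 := one_le_pow₀ le_self_add
  calc ∫⁻ ω, ENNReal.ofReal (f (X s ω) ^ 2) ∂μ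
      ≤ ∫⁻ ω, (C.toNNReal : ℝ≥0∞) * (1 + ∑ j, ENNReal.ofReal (|X s ω j - x j| ^ p)) ∂μ := by
        refine lintegral_mono fun ω => (ENNReal.ofReal_le_ofReal (hC _)).trans_eq ?_
        rw [ENNReal.ofReal_mul hC0, ENNReal.ofReal_add zero_le_one (sum_rpow_nonneg _ _ _),
          ENNReal.ofReal_one, ENNReal.ofReal_sum_of_nonneg fun j _ =>
            Real.rpow_nonneg (abs_nonneg _) _]
        rfl
    _ = (C.toNNReal : ℝ≥0∞) * (1 + ∑ j, ∫⁻ ω, ENNReal.ofReal (|X s ω j - x j| ^ p) ∂μ) := by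
        rw [lintegral_const_mul' _ _ ENNReal.coe_ne_top, lintegral_add_left measurable_const,
          lintegral_finsetSum _ fun j _ => hm j]
        simp
    _ ≤ (C.toNNReal : ℝ≥0∞) * ((1 + (s : ℝ≥0∞)) ^ 2 +
          ∑ _j : Fin d, K * (1 + (s : ℝ≥0∞)) ^ 2) := by
        gcongr with j
        exact hK Ω μ d X x hX j n k
    _ = _ := by
        rw [Finset.sum_const, Finset.card_univ, Fintype.card_fin, nsmul_eq_mul]
        push_cast
        ring

end Growth

/-! ### Second moment of the discretized functional -/

section Assembly

variable {Ω : Type*} [MeasurableSpace Ω] {μ : Measure Ω} {d : ℕ}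
  {X : ℝ≥0 → Ω → EuclideanSpace ℝ (Fin d)} {T : Ω → ℝ≥0}

lemma aemeasurable_discretized {φ g : EuclideanSpace ℝ (Fin d) → ℝ} (hφ : Continuous φ)
    (hg : Continuous g) (hX : ∀ s, Measurable (X s))
    (hc : ∀ᵐ ω ∂μ, ∀ s, ContinuousWithinAt (fun s => X s ω) (Set.Ici s) s) (hT : Measurable T)
    (h : ℝ≥0) : AEMeasurable (discretized φ g X T h) μ := by
  refine (hφ.measurable.comp_aemeasurable (aemeasurable_eval_time hX hc hT)).add
    (Measurable.aemeasurable ?_)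
  refine measurable_eval_nat (N := fun ω => ⌊T ω / h⌋₊)
    (V := fun n ω => ∑ i ∈ Finset.Icc 1 n, (h : ℝ) * g (X (((i - 1 : ℕ) : ℝ≥0) * h) ω))
    (Nat.measurable_floor.comp (hT.div_const h)) fun n => ?_
  exact Finset.measurable_sum _ fun i _ => (hg.measurable.comp (hX _)).const_mul _

/-- The fourth power is `T ^ 2` from the Riemann sum times `(2 + T) ^ 2` from the moment bound,
whose argument is shifted by `1` by the grid approximation. The `φ` term needs only the second
power. -/
lemma lintegral_sq_discretized_le [IsProbabilityMeasure μ]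
    {φ g : EuclideanSpace ℝ (Fin d) → ℝ} (hφ : Continuous φ)
    (hg : Continuous g) (hX : ∀ s, Measurable (X s))
    (hc : ∀ᵐ ω ∂μ, ∀ s, ContinuousWithinAt (fun s => X s ω) (Set.Ici s) s) (hT : Measurable T)
    (hind : IndepFun (fun ω s => X s ω) T μ) {K₁ K₂ : ℝ≥0}
    (h₁ : ∀ n k : ℕ, ∫⁻ ω, ENNReal.ofReal (φ (X (k / (n + 1)) ω) ^ 2) ∂μ ≤
      K₁ * (1 + ((k / (n + 1) : ℝ≥0) : ℝ≥0∞)) ^ 2)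
    (h₂ : ∀ n k : ℕ, ∫⁻ ω, ENNReal.ofReal (g (X (k / (n + 1)) ω) ^ 2) ∂μ ≤
      K₂ * (1 + ((k / (n + 1) : ℝ≥0) : ℝ≥0∞)) ^ 2) {h : ℝ≥0} (hh : 0 < h) :
    ∫⁻ ω, ENNReal.ofReal (discretized φ g X T h ω ^ 2) ∂μ ≤
      2 * (K₁ + K₂) * ∫⁻ ω, (2 + (T ω : ℝ≥0∞)) ^ 4 ∂μ := by
  have hmono : ∀ K : ℝ≥0, Monotone fun s : ℝ≥0 => (K : ℝ≥0∞) * (1 + (s : ℝ≥0∞)) ^ 2 := by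
    intro K s r hsr
    dsimp only
    gcongr
  have hshift : ∀ s : ℝ≥0, 1 + ((s + 1 : ℝ≥0) : ℝ≥0∞) = 2 + (s : ℝ≥0∞) := by
    intro s
    push_cast
    ring
  have hofReal : ∀ {f : EuclideanSpace ℝ (Fin d) → ℝ}, Continuous f →
      Continuous fun y => ENNReal.ofReal (f y ^ 2) :=
    fun hf => ENNReal.continuous_ofReal.comp (hf.pow 2)
  have hA : ∫⁻ ω, ENNReal.ofReal (φ (X (T ω) ω) ^ 2) ∂μ ≤
      K₁ * ∫⁻ ω, (2 + (T ω : ℝ≥0∞)) ^ 4 ∂μ := by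
    refine (lintegral_eval_time_le hX hc hT hind (hofReal hφ) (hmono K₁) h₁).trans ?_
    rw [← lintegral_const_mul' _ _ ENNReal.coe_ne_top]
    refine lintegral_mono fun ω => ?_
    dsimp only
    rw [hshift]
    have hone : (1 : ℝ≥0∞) ≤ 2 + (T ω : ℝ≥0∞) := one_le_two.trans le_self_add
    exact mul_le_mul' le_rfl (pow_le_pow_right₀ hone (by norm_num))
  have hB := lintegral_sq_riemann_sum_le hX hT hind hg
    (G := fun s => (K₂ : ℝ≥0∞) * (1 + ((s + 1 : ℝ≥0) : ℝ≥0∞)) ^ 2)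
    (fun s r hsr => hmono K₂ (add_le_add_left hsr 1))
    (fun s => lintegral_eval_const_le hX hc (hofReal hg) (hmono K₂) h₂ s) hh
  have hB' : ∫⁻ ω, ENNReal.ofReal ((∑ i ∈ Finset.Icc 1 ⌊T ω / h⌋₊,
        (h : ℝ) * g (X (((i - 1 : ℕ) : ℝ≥0) * h) ω)) ^ 2) ∂μ ≤
      K₂ * ∫⁻ ω, (2 + (T ω : ℝ≥0∞)) ^ 4 ∂μ := by
    refine hB.trans ?_
    rw [← lintegral_const_mul' _ _ ENNReal.coe_ne_top]
    refine lintegral_mono fun ω => ?_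
    dsimp only
    rw [hshift]
    calc (T ω : ℝ≥0∞) ^ 2 * (K₂ * (2 + (T ω : ℝ≥0∞)) ^ 2)
        ≤ (2 + (T ω : ℝ≥0∞)) ^ 2 * (K₂ * (2 + (T ω : ℝ≥0∞)) ^ 2) := by
          gcongr
          exact le_add_self
      _ = _ := by ring
  calc ∫⁻ ω, ENNReal.ofReal (discretized φ g X T h ω ^ 2) ∂μ
      ≤ ∫⁻ ω, (2 * ENNReal.ofReal (φ (X (T ω) ω) ^ 2) +
          2 * ENNReal.ofReal ((∑ i ∈ Finset.Icc 1 ⌊T ω / h⌋₊,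
            (h : ℝ) * g (X (((i - 1 : ℕ) : ℝ≥0) * h) ω)) ^ 2)) ∂μ := by
        refine lintegral_mono fun ω => ?_
        rw [← ENNReal.ofReal_ofNat 2, ← ENNReal.ofReal_mul zero_le_two,
          ← ENNReal.ofReal_mul zero_le_two, ← ENNReal.ofReal_add (by positivity) (by positivity),
          ← mul_add]
        exact ENNReal.ofReal_le_ofReal (add_sq_le)
    _ = 2 * (∫⁻ ω, ENNReal.ofReal (φ (X (T ω) ω) ^ 2) ∂μ) +
          2 * ∫⁻ ω, ENNReal.ofReal ((∑ i ∈ Finset.Icc 1 ⌊T ω / h⌋₊,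
            (h : ℝ) * g (X (((i - 1 : ℕ) : ℝ≥0) * h) ω)) ^ 2) ∂μ := by
        have hm : AEMeasurable (fun ω => ENNReal.ofReal (φ (X (T ω) ω) ^ 2)) μ :=
          (hofReal hφ).measurable.comp_aemeasurable (aemeasurable_eval_time hX hc hT)
        rw [lintegral_add_left' (hm.const_mul 2), lintegral_const_mul' _ _ ENNReal.ofNat_ne_top,
          lintegral_const_mul' _ _ ENNReal.ofNat_ne_top]
    _ ≤ _ := by
        rw [mul_assoc, add_mul, mul_add]
        gcongr

lemma memLp_and_variance_le [IsProbabilityMeasure μ] {Y : Ω → ℝ} (hY : AEMeasurable Y μ)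
    {K : ℝ≥0∞} (hK : K ≠ ⊤)
    (h : ∫⁻ ω, ENNReal.ofReal (Y ω ^ 2) ∂μ ≤ K) :
    MemLp Y 2 μ ∧ variance Y μ ≤ K.toReal := by
  have hint : Integrable (fun ω => Y ω ^ 2) μ := by
    refine ⟨(hY.pow_const 2).aestronglyMeasurable, ?_⟩
    rw [hasFiniteIntegral_iff_ofReal (Eventually.of_forall fun ω => sq_nonneg _)]
    exact h.trans_lt hK.lt_top
  refine ⟨(memLp_two_iff_integrable_sq hY.aestronglyMeasurable).2 hint, ?_⟩
  refine (variance_le_expectation_sq hY.aestronglyMeasurable).trans ?_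
  change ∫ ω, Y ω ^ 2 ∂μ ≤ K.toReal
  rw [integral_eq_lintegral_of_nonneg_ae (Eventually.of_forall fun ω => sq_nonneg _)
    hint.aestronglyMeasurable]
  exact ENNReal.toReal_mono hK h

end Assembly

end FracMC

end

theorem proposition3p2 {d : ℕ} (a t : ℝ) (hat : a < t) (x : EuclideanSpace ℝ (Fin d))
    (α : ℝ) (hα0 : 0 < α) (hα1 : α < 1)
    (β σ ρ m : ℝ) (hβ0 : 0 < β) (hβ2 : β ≤ 2) (hσ : 0 < σ) (hρ : |ρ| ≤ 1)
    (φ g : EuclideanSpace ℝ (Fin d) → ℝ)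
    (δ : ℝ) (hδ : 0 < δ) (hφ : Continuous φ)
    (hφO : φ =O[cocompact (EuclideanSpace ℝ (Fin d))] fun y => ‖y‖ ^ (β / (2 + δ)))
    (γ L : ℝ) (hγ0 : 0 < γ) (hγβ : γ < β / 2)
    (hg : ∀ y z, |g y - g z| ≤ L * FracMC.gammaNorm γ (y - z)) :
    ∃ M : ℝ, ∀ (Ω : Type*) [MeasurableSpace Ω] (μ : Measure Ω) [IsProbabilityMeasure μ]
      (X : ℝ≥0 → Ω → EuclideanSpace ℝ (Fin d)) (τ : ℝ≥0 → Ω → ℝ),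
      FracMC.IsIsotropicStableProcess β σ ρ m X x μ →
      FracMC.IsStableSubordinator α τ μ →
      IndepFun (fun ω s => X s ω) (fun ω s => τ s ω) μ →
      ∀ h : ℝ≥0, 0 < h →
        MemLp (FracMC.discretized φ g X (FracMC.hittingTime a t τ) h) 2 μ ∧
        variance (FracMC.discretized φ g X (FracMC.hittingTime a t τ) h) μ ≤ M := by
  have hq0 : 0 < β / (2 + δ) := by positivity
  have hqβ : 2 * (β / (2 + δ)) < β := by
    rw [← mul_div_assoc, div_lt_iff₀ (by positivity)]
    nlinarith
  -- One exponent serves both functions; `γ < β / 2` and `δ > 0` keep it strictly below `β`.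
  set p := max (2 * γ) (2 * (β / (2 + δ))) with hp
  have hp0 : 0 < p := lt_max_of_lt_left (by positivity)
  have hpβ : p < β := max_lt (by linarith) hqβ
  have hgc := FracMC.continuous_of_holder hγ0 hg
  obtain ⟨K₁, hK₁⟩ := FracMC.exists_sq_moment_bound (ρ := ρ) (m := m) hβ0 hβ2 hσ hp0 hpβ
    (FracMC.hasSqGrowth_of_isBigO hφ hφO hq0 (le_max_right _ _) (hpβ.le.trans hβ2) x)
  obtain ⟨K₂, hK₂⟩ := FracMC.exists_sq_moment_bound (ρ := ρ) (m := m) hβ0 hβ2 hσ hp0 hpβ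
    (FracMC.hasSqGrowth_of_holder hγ0 (le_max_left _ _) hg x)
  obtain ⟨K, hK, hKT⟩ := FracMC.exists_moment_bound_hitting hα0 hα1 a t
  have hM : 2 * ((K₁ : ENNReal) + K₂) * K ≠ ⊤ :=
    ENNReal.mul_ne_top (ENNReal.mul_ne_top ENNReal.ofNat_ne_top
      (ENNReal.add_ne_top.2 ⟨ENNReal.coe_ne_top, ENNReal.coe_ne_top⟩)) hK
  refine ⟨(2 * ((K₁ : ENNReal) + K₂) * K).toReal, fun Ω _ μ _ X τ hX hτ hind h hh => ?_⟩
  have hXm : ∀ s, Measurable (X s) := hX.levy.measurable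
  have hXc : ∀ᵐ ω ∂μ, ∀ s, ContinuousWithinAt (fun s => X s ω) (Set.Ici s) s :=
    hX.levy.cadlag.mono fun ω hω s => (hω s).1
  have hF := FracMC.measurable_countableHitting (t - a)
  set T : Ω → ℝ≥0 := fun ω => FracMC.countableHitting (t - a) (fun s => τ s ω) with hT
  have hTm : Measurable T := hF.comp (measurable_pi_lambda _ hτ.levy.measurable)
  have hTind : IndepFun (fun ω s => X s ω) T μ := hind.comp measurable_id hF
  -- The estimates concern the measurable version `T`; they transfer because paths of `τ` are almost
  -- surely monotone.
  have heq : FracMC.discretized φ g X (FracMC.hittingTime a t τ) h =ᵐ[μ]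
      FracMC.discretized φ g X T h := by
    filter_upwards [hτ.mono] with ω hω
    simp only [FracMC.discretized, hT,
      FracMC.hittingTime_eq_countableHitting a t τ ω hω]
  have hsq := FracMC.lintegral_sq_discretized_le hφ hgc hXm hXc hTm hTind
    (hK₁ Ω μ X hX) (hK₂ Ω μ X hX) hh
  have hfin := FracMC.memLp_and_variance_le
    (FracMC.aemeasurable_discretized hφ hgc hXm hXc hTm h) hM
    (hsq.trans (by gcongr; exact hKT Ω μ τ hτ))
  exact ⟨hfin.1.ae_eq heq.symm, by rw [variance_congr heq]; exact hfin.2⟩
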